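/- Let $K$ be an algebraically closed field, let $r\ge s\ge 0$ be integers, $n=r+s$, and let $V$ be a $K$-vector space with basis $e_1,\dots,e_n$. Let $u\in\mathrm{End}(V)$ be the nilpotent endomorphism with $u(e_i)=0$ for $1\le i\le r$ and $u(e_i)=e_{i-r}$ for $r+1\le i\le n$; thus $u^2=0$, and the Young diagram whose row lengths are the sizes of the Jordan blocks of $u$ has two columns, of lengths $r\ge s$ (only one column if $s=0<r$). Let $\mathcal B_u$ be the Springer fiber of $u$, that is, the closed subvariety of the variety of complete flags of $V$ formed by the flags $(V_0\subset V_1\subset\dots\subset V_n=V)$ such that $u(V_i)\subset V_i$ for every $i$. Let $F_{\overline T}\in\mathcal B_u$ be the flag whose $i$-th subspace is $\langle e_1,\dots,e_i\rangle$ for $0\le i\le n$. Irreducible components of $\mathcal B_u$ are taken in the Zariski topology and carry their reduced structure; a component is nonsingular if all its points are nonsingular. Then: (a) the flag $F_{\overline T}$ belongs to every irreducible component of $\mathcal B_u$; (b) an irreducible component $\mathcal K\subset\mathcal B_u$ is nonsingular if and only if $F_{\overline T}$ is a nonsingular point of $\mathcal K$. -/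

import Mathlib

noncomputable section

/-- A complete flag `V_0 ⊂ V_1 ⊂ ... ⊂ V_n = V` of subspaces of `V`, with `dim V_i = i`. -/
@[ext]
structure CompleteFlag (K V : Type*) [Field K] [AddCommGroup V] [Module K V] (n : ℕ) where
  space : Fin (n + 1) → Submodule K V
  mono : Monotone space
  finrank_space : ∀ i, Module.finrank K (space i) = (i : ℕ)
  top : space (Fin.last n) = ⊤

namespace CompleteFlag

variable {K V : Type*} [Field K] [AddCommGroup V] [Module K V] {n : ℕ}

/-- The flag spanned successively by the vectors of a basis: its `i`-th subspace is the span
of the first `i` vectors. -/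
def ofBasis (b : Module.Basis (Fin n) K V) : CompleteFlag K V n where
  space := b.flag
  mono := b.flag_mono
  finrank_space := by
    intro i
    have hli : LinearIndependent K (fun j : {j : Fin n | j.castSucc < i} => b j) :=
      b.linearIndependent.comp _ Subtype.val_injective
    have h := finrank_span_eq_card hli
    have hc : Fintype.card {j : Fin n | j.castSucc < i} = (i : ℕ) := by
      rw [Fintype.card_subtype]
      simp only [Fin.lt_def, Fin.val_castSucc, Set.mem_ofPred_eq, Fin.card_filter_val_lt]
      exact min_eq_right (Nat.lt_succ_iff.mp i.isLt)
    rw [Module.Basis.flag, Set.image_eq_range]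
    rw [h, hc]
  top := b.flag_last

end CompleteFlag

/-- The Zariski topology on a finite-dimensional vector space `W` over `K`, without choice of
coordinates: the sets where a polynomial in linear forms does not vanish form a basis. -/
@[reducible] def zariskiTopology (K W : Type*) [Field K] [AddCommGroup W] [Module K W] :
    TopologicalSpace W :=
  TopologicalSpace.generateFrom
    (Set.range fun p : MvPolynomial (Module.Dual K W) K =>
      {w : W | MvPolynomial.eval (fun f : Module.Dual K W => f w) p ≠ 0})

/-- The Zariski topology of the flag variety. The set of bases `(b_1, ..., b_n)` of `V` is a
principal homogeneous space of `GL(V)`, open in `V ^ n`; it carries the subspace topology, and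
the flag variety, being the quotient of it by the group of triangular matrices, carries the
quotient topology. -/
instance CompleteFlag.instTopologicalSpace {K V : Type*} [Field K] [AddCommGroup V] [Module K V]
    {n : ℕ} : TopologicalSpace (CompleteFlag K V n) :=
  TopologicalSpace.coinduced CompleteFlag.ofBasis
    (TopologicalSpace.induced (fun (b : Module.Basis (Fin n) K V) (i : Fin n) => b i)
      (zariskiTopology K (Fin n → V)))

/-- The Springer fiber `B_u`: the complete flags all of whose subspaces are stable under `u`. -/
def springerFiber {K V : Type*} [Field K] [AddCommGroup V] [Module K V] (n : ℕ)
    (u : Module.End K V) : Set (CompleteFlag K V n) :=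
  {F | ∀ i, ∀ v ∈ F.space i, u v ∈ F.space i}

section LocalRing

variable {K σ : Type*} [Field K]

/-- The coordinate ring of a subset `X` of the affine space `K ^ σ`: the ring of functions on `X`
that are restrictions of polynomials, that is, polynomials modulo those vanishing on `X`. -/
def coordinateRing (X : Set (σ → K)) : Subalgebra K (X → K) :=
  (MvPolynomial.aeval (fun (i : σ) (x : X) => (x : σ → K) i) :
    MvPolynomial σ K →ₐ[K] (X → K)).range

/-- Evaluation of polynomial functions on `X` at the point `x` of `X`. -/
def evalAt (X : Set (σ → K)) (x : X) : coordinateRing X →+* K :=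
  (Pi.evalRingHom (fun _ : X => K) x).comp (coordinateRing X).val.toRingHom

instance isPrime_ker_evalAt (X : Set (σ → K)) (x : X) : (RingHom.ker (evalAt X x)).IsPrime :=
  RingHom.ker_isPrime _

/-- The local ring at `x` of the affine variety `X` (with its reduced structure): the localization
of the coordinate ring at the maximal ideal of the functions vanishing at `x`. -/
abbrev affineLocalRing (X : Set (σ → K)) (x : X) : Type _ :=
  Localization.AtPrime (RingHom.ker (evalAt X x))

end LocalRing

namespace CompleteFlag

variable {K V : Type*} [Field K] [AddCommGroup V] [Module K V] {n : ℕ}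

/-- The affine chart of the flag variety attached to a basis `b` (a big cell containing the
flag of `b`): `F` is the flag with coordinates `x` if it is spanned successively by
the vectors `f_i = b_i + ∑ x_{i,j} b_j`, the sum being over `j > i`. A flag has at most one system
of coordinates in the chart of `b`, and the charts cover the flag variety by open
affine spaces of dimension `n (n - 1) / 2`. -/
def HasCoordinates (F : CompleteFlag K V n) (b : Module.Basis (Fin n) K V)
    (x : {p : Fin n × Fin n // p.1 < p.2} → K) : Prop :=
  ∃ f : Module.Basis (Fin n) K V,
    (∀ i, f i = b i + ∑ j : {j : Fin n // i < j}, x ⟨(i, j.1), j.2⟩ • b j.1) ∧ F = ofBasis f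

/-- The part of a set `Z` of flags in the chart attached to `b`, as a subset of affine space. -/
def chartTrace (Z : Set (CompleteFlag K V n)) (b : Module.Basis (Fin n) K V) :
    Set ({p : Fin n × Fin n // p.1 < p.2} → K) :=
  {x | ∃ F ∈ Z, F.HasCoordinates b x}

/-- `F` is a nonsingular point of the closed subvariety `Z` (with its reduced structure) of the flag
variety: `F` belongs to `Z` and the local ring of `Z` at `F` is a regular local ring. The local
ring is computed in an affine chart containing `F`; different charts give isomorphic rings. -/
def IsNonsingularPoint (Z : Set (CompleteFlag K V n)) (F : CompleteFlag K V n) : Prop :=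
  F ∈ Z ∧ ∃ (b : Module.Basis (Fin n) K V) (x : chartTrace Z b),
    F.HasCoordinates b x ∧ IsRegularLocalRing (affineLocalRing (chartTrace Z b) x)

/-- A closed subvariety of the flag variety is nonsingular if all its points are. -/
def IsNonsingular (Z : Set (CompleteFlag K V n)) : Prop :=
  ∀ F ∈ Z, IsNonsingularPoint Z F

/-- The irreducible components of a set `B` of flags, for the Zariski topology. -/
def components (B : Set (CompleteFlag K V n)) : Set (Set (CompleteFlag K V n)) :=
  (fun Z : Set B => Subtype.val '' Z) '' irreducibleComponents B

end CompleteFlag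

end

/-! Let `G` be the group of linear automorphisms commuting with `u`. Two elements of `G` are joined
by an affine line of endomorphisms commuting with `u`, all but finitely many of them invertible. So
the `G`-translates of an irreducible set form an irreducible set (`isIrreducible_setOf_map`), and by
maximality every component of the Springer fiber is `G`-stable (`map_mem_of_mem_components`).

The heart is `orbitMeets_of_ofBasis_mem`: every open set containing the standard flag meets the
`G`-orbit of every flag, so the standard flag lies in every orbit closure. Components are closed in
the Springer fiber and `G`-stable, which gives (a). For (b), the nonsingular points of a component
form an open `G`-stable subset (`IsNonsingularPoint.exists_isOpen`, `IsNonsingularPoint.map`); if it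
contains the standard flag, it meets every orbit of the component and is everything.

The degeneration is a chain of elementary moves (`OrbitMeets.of_swap`): under `1 + t⁻¹ h`, with `h`
commuting with `u` and sending `f i` to `f j`, the flag of `f` tends, as `t → 0`, to the flag with
`f i` and `f j` exchanged. Sorting an adapted basis by such moves makes the flag pass through a
prescribed chain: first image and kernel of `u`, then the images `u(F_{r+j})`. The resulting flag
has a basis on which `u` acts as on `e`, so it is a `G`-translate of the standard flag.

Openness of the regular locus is checked in charts. Differentials of generators of one maximal ideal
modulo its square generate the Kähler differentials nearby, which bounds the embedding dimension at
nearby points, while all maximal ideals have the same height. -/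

open scoped Topology

/-! ### Equidimensionality of affine domains -/

section Dimension

/-- Remove one variable at a time: by the Jacobson property a maximal ideal contracts to a maximal
ideal, and the height drops by exactly one. -/
theorem MvPolynomial.height_eq_card_of_isMaximal {k : Type*} [Field k] {ι : Type*} [Finite ι]
    (P : Ideal (MvPolynomial ι k)) [P.IsMaximal] : P.height = Nat.card ι := by
  induction ι using Finite.induction_empty_option with
  | of_equiv e H =>
    have h := H (P.comap (MvPolynomial.renameEquiv k e).toRingEquiv)
    rw [RingEquiv.height_comap] at h
    rw [h, Nat.card_congr e]
  | h_empty =>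
    have h1 := Ideal.height_le_ringKrullDim_of_ne_top (Ideal.IsMaximal.ne_top (I := P) inferInstance)
    rw [MvPolynomial.ringKrullDim_of_isNoetherianRing, ringKrullDim_eq_zero_of_field] at h1
    simpa using h1
  | h_option IH =>
    rename_i α _ _
    let e := (MvPolynomial.optionEquivLeft k α).toRingEquiv
    let P' := P.comap e.symm
    have hP' : P'.height = P.height := RingEquiv.height_comap e.symm P
    have hmax : (P'.comap Polynomial.C).IsMaximal :=
      Polynomial.isMaximal_comap_C_of_isJacobsonRing P'
    have : P'.LiesOver (P'.comap Polynomial.C) := ⟨rfl⟩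
    have h := Polynomial.height_eq_height_add_one (P'.comap Polynomial.C) P'
    rw [IH] at h
    rw [← hP', h, Nat.card_eq_fintype_card, Nat.card_eq_fintype_card, Fintype.card_option]
    simp

/-- Noether normalization: going down over a polynomial ring shows that both heights equal its
number of variables. -/
theorem Ideal.height_eq_height_of_isMaximal (k : Type*) {A : Type*} [Field k] [CommRing A]
    [IsDomain A] [Algebra k A] [Algebra.FiniteType k A] (P Q : Ideal A) [P.IsMaximal]
    [Q.IsMaximal] : P.height = Q.height := by
  obtain ⟨s, g, hinj, hint⟩ := exists_integral_inj_algHom_of_fg k A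
  algebraize [g.toRingHom]
  have : FaithfulSMul (MvPolynomial (Fin s) k) A :=
    (faithfulSMul_iff_algebraMap_injective _ _).mpr hinj
  have : IsNoetherianRing A := Algebra.FiniteType.isNoetherianRing k A
  have key : ∀ (P : Ideal A) [P.IsMaximal], P.height = s := by
    intro P _
    have : (P.under (MvPolynomial (Fin s) k)).IsMaximal :=
      Ideal.isMaximal_comap_of_isIntegral_of_isMaximal P
    rw [Ideal.height_eq_height_add_of_liesOver_of_hasGoingDown
      (P.under (MvPolynomial (Fin s) k)) P, MvPolynomial.height_eq_card_of_isMaximal]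
    -- The fibre contributes nothing: a prime of the fibre ring below the image of `P` lies over the
    -- same maximal ideal, hence is itself maximal by integrality.
    suffices h : (P.map (Ideal.Quotient.mk
        ((P.under (MvPolynomial (Fin s) k)).map (algebraMap (MvPolynomial (Fin s) k) A)))).height
        = 0 by
      rw [h]; simp
    have hle : (P.under (MvPolynomial (Fin s) k)).map (algebraMap (MvPolynomial (Fin s) k) A) ≤ P :=
      Ideal.map_comap_le
    have hpr := Ideal.isPrime_map_quotientMk_of_isPrime hle
    rw [Ideal.height_eq_zero_iff]
    refine ⟨⟨hpr, bot_le⟩, ?_⟩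
    rintro J ⟨hJ, -⟩ hJP
    have hJ' : (J.comap (Ideal.Quotient.mk _)).IsMaximal := by
      refine Ideal.isMaximal_of_isIntegral_of_isMaximal_comap (R := MvPolynomial (Fin s) k) _ ?_
      convert ‹(P.under (MvPolynomial (Fin s) k)).IsMaximal› using 1
      refine (Ideal.IsMaximal.eq_of_le ‹_› (Ideal.IsPrime.ne_top inferInstance) ?_).symm
      intro x hx
      simp only [Ideal.mem_comap]
      have : Ideal.Quotient.mk ((P.under (MvPolynomial (Fin s) k)).map
        (algebraMap (MvPolynomial (Fin s) k) A)) (algebraMap _ A x) = 0 :=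
        Ideal.Quotient.eq_zero_iff_mem.mpr (Ideal.mem_map_of_mem _ hx)
      rw [this]
      exact J.zero_mem
    have hJmax : J.IsMaximal := by
      rw [← Ideal.map_comap_of_surjective _ Ideal.Quotient.mk_surjective J]
      exact Ideal.IsMaximal.map_of_surjective_of_ker_le Ideal.Quotient.mk_surjective
        (by intro x hx; rw [Ideal.mem_comap, RingHom.mem_ker.mp hx]; exact J.zero_mem)
    exact (hJmax.eq_of_le hpr.ne_top hJP).ge
  rw [key P, key Q]

end Dimension

/-! ### Openness of the regular locus via Kähler differentials -/

section RegularLocus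

variable {K A : Type*} [Field K] [CommRing A] [Algebra K A]

/-- The derivation sending `a` to the class of `a - ε a` in the cotangent space of a rational
point `ε`. -/
noncomputable def cotangentDerivation (ε : A →+* K) (hε : ∀ c, ε (algebraMap K A c) = c) :
    Derivation K A (RingHom.ker ε).Cotangent where
  toFun a := (RingHom.ker ε).toCotangent ⟨a - algebraMap K A (ε a), by simp [RingHom.mem_ker, hε]⟩
  map_add' a b := by
    rw [← map_add]
    congr 1
    ext
    simp only [map_add, Submodule.coe_add]
    ring
  map_smul' c a := by
    rw [RingHom.id_apply, ← algebraMap_smul A c (_ : (RingHom.ker ε).Cotangent), ← map_smul]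
    congr 1
    ext
    simp only [Algebra.smul_def, map_mul, hε, SetLike.val_smul, mul_sub]
    simp
  map_one_eq_zero' := by
    simp only [LinearMap.coe_mk, AddHom.coe_mk, map_one, sub_self]
    exact map_zero _
  leibniz' a b := by
    simp only [LinearMap.coe_mk, AddHom.coe_mk]
    rw [← map_smul, ← map_smul, ← map_add, Ideal.toCotangent_eq]
    have : (a * b - algebraMap K A (ε (a * b))) - (a * (b - algebraMap K A (ε b)) +
        b * (a - algebraMap K A (ε a))) =
        -((a - algebraMap K A (ε a)) * (b - algebraMap K A (ε b))) := by
      simp only [map_mul]; ring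
    simp only [Submodule.coe_add, SetLike.val_smul, smul_eq_mul]
    rw [this, pow_two]
    exact neg_mem (Ideal.mul_mem_mul (by simp [RingHom.mem_ker, hε]) (by simp [RingHom.mem_ker, hε]))

theorem cotangentDerivation_apply (ε : A →+* K) (hε : ∀ c, ε (algebraMap K A c) = c) (a : A) :
    cotangentDerivation ε hε a =
      (RingHom.ker ε).toCotangent ⟨a - algebraMap K A (ε a), by simp [RingHom.mem_ker, hε]⟩ := rfl

/-- The cotangent derivation at `ε` factors through the differentials and sends `D (g i)` to the
class of `g i - ε (g i)`; these classes span because `a` acts on the cotangent space as the nonzero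
scalar `ε a`. -/
theorem ker_le_span_sup_sq_of_smul_D_mem {d : ℕ} {g : Fin d → A} {a : A}
    (ha : ∀ h, a • KaehlerDifferential.D K A h ∈
      Submodule.span A (Set.range fun i => KaehlerDifferential.D K A (g i)))
    (ε : A →+* K) (hε : ∀ c, ε (algebraMap K A c) = c) (hεa : ε a ≠ 0) :
    RingHom.ker ε ≤
      Ideal.span (Set.range fun i => g i - algebraMap K A (ε (g i))) ⊔ RingHom.ker ε ^ 2 := by
  intro h hh
  set J := Ideal.span (Set.range fun i => g i - algebraMap K A (ε (g i))) ⊔ RingHom.ker ε ^ 2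
  have h1 := Submodule.mem_map_of_mem (f := (cotangentDerivation ε hε).liftKaehlerDifferential)
    (ha h)
  rw [Submodule.map_span, map_smul, Derivation.liftKaehlerDifferential_comp_D,
    ← Set.range_comp] at h1
  have h2 : Submodule.span A (Set.range ((cotangentDerivation ε hε).liftKaehlerDifferential ∘
      fun i => KaehlerDifferential.D K A (g i))) ≤
      (Submodule.comap (RingHom.ker ε).subtype J).map (RingHom.ker ε).toCotangent := by
    rw [Submodule.span_le]
    rintro _ ⟨i, rfl⟩
    simp only [Function.comp, Derivation.liftKaehlerDifferential_comp_D, cotangentDerivation_apply]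
    refine Submodule.mem_map_of_mem ?_
    exact Ideal.mem_sup_left (Ideal.subset_span ⟨i, rfl⟩)
  obtain ⟨⟨j, hj⟩, hjJ, hje⟩ := h2 h1
  rw [cotangentDerivation_apply, ← LinearMap.map_smul, Ideal.toCotangent_eq] at hje
  simp only [RingHom.mem_ker.mp hh, map_zero, sub_zero, SetLike.val_smul, smul_eq_mul] at hje
  have hah : a * h ∈ J := by
    have : a * h = j - (j - a * h) := by ring
    rw [this]
    exact sub_mem hjJ (Ideal.mem_sup_right hje)
  have h3 : h = algebraMap K A (ε a)⁻¹ * (a * h) -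
      algebraMap K A (ε a)⁻¹ * ((a - algebraMap K A (ε a)) * h) := by
    have : algebraMap K A (ε a)⁻¹ * algebraMap K A (ε a) = 1 := by
      rw [← map_mul, inv_mul_cancel₀ hεa, map_one]
    linear_combination (-h) * this
  rw [h3]
  refine sub_mem (Ideal.mul_mem_left _ _ hah) (Ideal.mul_mem_left _ _ (Ideal.mem_sup_right ?_))
  rw [pow_two]
  exact Ideal.mul_mem_mul (by simp [RingHom.mem_ker, hε]) hh

/-- By the Leibniz rule, differentials of elements of `m ^ 2` lie in `m • Ω`, so the `D (g i)`
generate `Ω` modulo `m • Ω`; Nakayama extends this to a neighbourhood of `ε`. -/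
theorem exists_smul_D_mem_span [Algebra.FiniteType K A] {d : ℕ} {g : Fin d → A}
    (ε : A →+* K) (hε : ∀ c, ε (algebraMap K A c) = c)
    (hg : RingHom.ker ε ≤ Ideal.span (Set.range g) ⊔ RingHom.ker ε ^ 2)
    (hgε : ∀ i, g i ∈ RingHom.ker ε) :
    ∃ a, ε a ≠ 0 ∧ ∀ h, a • KaehlerDifferential.D K A h ∈
      Submodule.span A (Set.range fun i => KaehlerDifferential.D K A (g i)) := by
  set m := RingHom.ker ε
  set N := Submodule.span A (Set.range fun i => KaehlerDifferential.D K A (g i))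
  have key : ∀ h, KaehlerDifferential.D K A h ∈
      N ⊔ m • (⊤ : Submodule A (Ω[A⁄K])) := by
    have hm : ∀ h ∈ m, KaehlerDifferential.D K A h ∈ N ⊔ m • (⊤ : Submodule A (Ω[A⁄K])) := by
      intro h hh
      obtain ⟨p, hp, q, hq, rfl⟩ := Submodule.mem_sup.mp (hg hh)
      rw [map_add]
      refine add_mem ?_ ?_
      · clear hh
        induction hp using Submodule.span_induction with
        | mem x hx =>
          obtain ⟨i, rfl⟩ := hx
          exact Submodule.mem_sup_left (Submodule.subset_span ⟨i, rfl⟩)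
        | zero => simp
        | add x y _ _ hx hy => rw [map_add]; exact add_mem hx hy
        | smul c x hx hx' =>
          rw [smul_eq_mul, Derivation.leibniz]
          refine add_mem (Submodule.smul_mem _ _ hx') (Submodule.mem_sup_right ?_)
          refine Submodule.smul_mem_smul ?_ trivial
          refine (Ideal.span_le.mpr ?_ : Ideal.span (Set.range g) ≤ m) hx
          rintro _ ⟨i, rfl⟩
          exact hgε i
      · refine Submodule.mem_sup_right ?_
        clear hh
        rw [pow_two] at hq
        induction hq using Submodule.mul_induction_on' with
        | mem_mul_mem x hx y hy =>
          rw [Derivation.leibniz]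
          exact add_mem (Submodule.smul_mem_smul hx trivial) (Submodule.smul_mem_smul hy trivial)
        | add x _ y _ hx hy => rw [map_add]; exact add_mem hx hy
    intro h
    have : h = (h - algebraMap K A (ε h)) + algebraMap K A (ε h) := by ring
    rw [this, map_add, Derivation.map_algebraMap, add_zero]
    exact hm _ (by simp [m, RingHom.mem_ker, hε])
  have htop : (⊤ : Submodule A (Ω[A⁄K])) ≤ N ⊔ m • (⊤ : Submodule A (Ω[A⁄K])) := by
    rw [← KaehlerDifferential.span_range_derivation, Submodule.span_le]
    rintro _ ⟨h, rfl⟩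
    rw [KaehlerDifferential.span_range_derivation]
    exact key h
  -- Since `Ω / N = m (Ω / N)`, Nakayama gives an annihilator congruent to 1 modulo `m`, hence
  -- nonzero at `ε`.
  obtain ⟨r, hr, hrN⟩ := Submodule.exists_sub_one_mem_and_smul_eq_zero_of_fg_of_le_smul m
    (⊤ : Submodule A ((Ω[A⁄K]) ⧸ N)) Module.Finite.fg_top (by
      have := Submodule.map_mono (f := N.mkQ) htop
      rw [Submodule.map_sup, Submodule.map_smul'', Submodule.map_top, Submodule.range_mkQ] at this
      simpa using this)
  refine ⟨r, ?_, fun h => ?_⟩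
  · have : ε (r - 1) = 0 := hr
    rw [map_sub, map_one, sub_eq_zero] at this
    rw [this]
    exact one_ne_zero
  · rw [← Submodule.Quotient.mk_eq_zero, Submodule.Quotient.mk_smul]
    exact hrN _ trivial

theorem spanFinrank_maximalIdeal_localization_le {B : Type*} [CommRing B] [IsNoetherianRing B]
    (m : Ideal B) [m.IsPrime] {d : ℕ} {g : Fin d → B} (hgm : ∀ i, g i ∈ m)
    (hg : m ≤ Ideal.span (Set.range g) ⊔ m ^ 2) :
    (IsLocalRing.maximalIdeal (Localization.AtPrime m)).spanFinrank ≤ d := by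
  set S := Localization.AtPrime m
  have hmap : m.map (algebraMap B S) = IsLocalRing.maximalIdeal S :=
    Localization.AtPrime.map_eq_maximalIdeal
  have h1 : IsLocalRing.maximalIdeal S ≤ Ideal.span (Set.range (algebraMap B S ∘ g)) := by
    refine Submodule.le_of_le_smul_of_le_jacobson_bot
      (I := IsLocalRing.maximalIdeal S) (IsNoetherian.noetherian _)
      (IsLocalRing.maximalIdeal_le_jacobson _) ?_
    have := Ideal.map_mono (f := algebraMap B S) hg
    rw [Ideal.map_sup, Ideal.map_pow, hmap, Ideal.map_span, ← Set.range_comp, pow_two] at this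
    exact this
  have h2 : IsLocalRing.maximalIdeal S = Ideal.span (Set.range (algebraMap B S ∘ g)) := by
    refine le_antisymm h1 (Ideal.span_le.mpr ?_)
    rintro _ ⟨i, rfl⟩
    rw [← hmap]
    exact Ideal.mem_map_of_mem _ (hgm i)
  rw [h2]
  refine (Submodule.spanFinrank_span_le_ncard_of_finite (Set.finite_range _)).trans ?_
  rw [← Set.image_univ]
  exact (Set.ncard_image_le Set.finite_univ).trans (by simp)

/-- Clear denominators in a minimal generating set of the local maximal ideal. Modulo `m ^ 2`, a
denominator acts on `m` as a nonzero scalar. -/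
theorem exists_generators_mod_sq [IsNoetherianRing A]
    (ε : A →+* K) [(RingHom.ker ε).IsPrime] (hε : ∀ c, ε (algebraMap K A c) = c) :
    ∃ g : Fin (IsLocalRing.maximalIdeal
        (Localization.AtPrime (RingHom.ker ε))).spanFinrank → A,
      (∀ i, g i ∈ RingHom.ker ε) ∧
        RingHom.ker ε ≤ Ideal.span (Set.range g) ⊔ RingHom.ker ε ^ 2 := by
  let m := RingHom.ker ε
  let S := Localization.AtPrime m
  have hfg : (IsLocalRing.maximalIdeal S).FG := IsNoetherian.noetherian _
  have hcard := Submodule.FG.generators_ncard hfg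
  have hfin := Submodule.FG.finite_generators hfg
  have : Finite (IsLocalRing.maximalIdeal S).generators := hfin
  let φ : Fin (IsLocalRing.maximalIdeal S).spanFinrank ≃ (IsLocalRing.maximalIdeal S).generators :=
    (Finite.equivFinOfCardEq (by rw [← hcard]; rfl)).symm
  have hG : ∀ i, ∃ a : A, ∃ s : m.primeCompl,
      algebraMap A S a = (φ i : S) * algebraMap A S s := by
    intro i
    obtain ⟨⟨a, s⟩, h⟩ := IsLocalization.surj m.primeCompl (φ i : S)
    exact ⟨a, s, h.symm⟩
  choose g s hgs using hG
  have hspan : Ideal.span (Set.range (algebraMap A S ∘ g)) = IsLocalRing.maximalIdeal S := by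
    have h1 : IsLocalRing.maximalIdeal S = Ideal.span (Set.range fun i => (φ i : S)) := by
      conv_lhs => rw [← Submodule.span_generators (IsLocalRing.maximalIdeal S)]
      congr 1
      ext z
      constructor
      · intro hz
        exact ⟨φ.symm ⟨z, hz⟩, by simp⟩
      · rintro ⟨i, rfl⟩
        exact (φ i).2
    refine Eq.trans ?_ h1.symm
    apply le_antisymm
    · rw [Ideal.span_le]
      rintro _ ⟨i, rfl⟩
      simp only [Function.comp, hgs]
      exact Ideal.mul_mem_right _ _ (Ideal.subset_span ⟨i, rfl⟩)
    · rw [Ideal.span_le]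
      rintro _ ⟨i, rfl⟩
      have hu := IsLocalization.map_units S (s i)
      simp only [SetLike.mem_coe]
      rw [← Ideal.mul_unit_mem_iff_mem _ hu, ← hgs]
      exact Ideal.subset_span ⟨i, rfl⟩
  refine ⟨g, fun i => ?_, fun a ha => ?_⟩
  · have h1 : algebraMap A S (g i) ∈ IsLocalRing.maximalIdeal S :=
      hspan ▸ Ideal.subset_span ⟨i, rfl⟩
    rwa [IsLocalization.AtPrime.to_map_mem_maximal_iff S m] at h1
  · have h1 : algebraMap A S a ∈ (Ideal.span (Set.range g)).map (algebraMap A S) := by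
      rw [Ideal.map_span, ← Set.range_comp, hspan, ← Localization.AtPrime.map_eq_maximalIdeal]
      exact Ideal.mem_map_of_mem _ ha
    obtain ⟨t, ht, hta⟩ := (IsLocalization.algebraMap_mem_map_algebraMap_iff m.primeCompl S _ _).mp h1
    have ht' : ε t ≠ 0 := ht
    have h3 : a = algebraMap K A (ε t)⁻¹ * (t * a) -
        algebraMap K A (ε t)⁻¹ * ((t - algebraMap K A (ε t)) * a) := by
      have : algebraMap K A (ε t)⁻¹ * algebraMap K A (ε t) = 1 := by
        rw [← map_mul, inv_mul_cancel₀ ht', map_one]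
      linear_combination (-a) * this
    rw [h3]
    refine sub_mem (Ideal.mul_mem_left _ _ (Ideal.mem_sup_left hta))
      (Ideal.mul_mem_left _ _ (Ideal.mem_sup_right ?_))
    rw [pow_two]
    exact Ideal.mul_mem_mul (by simp [RingHom.mem_ker, hε]) ha

/-- The regular locus is open: if the local ring at a rational point of an integral scheme of finite
type over a field is regular, then so are the local rings at the nearby rational points. -/
theorem exists_forall_isRegularLocalRing_localization [IsDomain A] [Algebra.FiniteType K A]
    (ε : A →+* K) [(RingHom.ker ε).IsPrime] (hε : ∀ c, ε (algebraMap K A c) = c)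
    (hreg : IsRegularLocalRing (Localization.AtPrime (RingHom.ker ε))) :
    ∃ a, ε a ≠ 0 ∧ ∀ (η : A →+* K) [(RingHom.ker η).IsPrime],
      (∀ c, η (algebraMap K A c) = c) → η a ≠ 0 →
      IsRegularLocalRing (Localization.AtPrime (RingHom.ker η)) := by
  have : IsNoetherianRing A := Algebra.FiniteType.isNoetherianRing K A
  obtain ⟨g, hgm, hg⟩ := exists_generators_mod_sq ε hε
  obtain ⟨a, ha, haD⟩ := exists_smul_D_mem_span ε hε hg hgm
  refine ⟨a, ha, fun η _ hη hηa => ?_⟩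
  apply IsRegularLocalRing.of_spanFinrank_maximalIdeal_le
  have h1 := spanFinrank_maximalIdeal_localization_le (RingHom.ker η)
    (g := fun i => g i - algebraMap K A (η (g i))) (fun i => by simp [RingHom.mem_ker, hη])
    (ker_le_span_sup_sq_of_smul_D_mem haD η hη hηa)
  have hmax : ∀ ε : A →+* K, (∀ c, ε (algebraMap K A c) = c) → (RingHom.ker ε).IsMaximal :=
    fun ε hε => RingHom.ker_isMaximal_of_surjective ε fun c => ⟨_, hε c⟩
  have := hmax ε hε
  have := hmax η hη
  rw [IsLocalization.AtPrime.ringKrullDim_eq_height (RingHom.ker η),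
    Ideal.height_eq_height_of_isMaximal K (RingHom.ker η) (RingHom.ker ε),
    ← IsLocalization.AtPrime.ringKrullDim_eq_height (RingHom.ker ε)
      (Localization.AtPrime (RingHom.ker ε)), ← hreg.spanFinrank_maximalIdeal]
  exact_mod_cast h1

end RegularLocus

/-! ### Zariski topology and polynomial functions -/

section ZariskiTopology

variable {K W W' : Type*} [Field K] [AddCommGroup W] [Module K W] [AddCommGroup W'] [Module K W']

/-- The polynomial functions on a vector space. -/
noncomputable def vectorSpacePolynomials (K W : Type*) [Field K] [AddCommGroup W] [Module K W] :
    Subalgebra K (W → K) :=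
  (MvPolynomial.aeval (fun (f : Module.Dual K W) (w : W) => f w) :
    MvPolynomial (Module.Dual K W) K →ₐ[K] (W → K)).range

theorem dual_mem_vectorSpacePolynomials (f : Module.Dual K W) :
    (fun w => f w) ∈ vectorSpacePolynomials K W :=
  ⟨MvPolynomial.X f, by simp⟩

theorem aeval_fun_apply {σ S : Type*} (y : σ → S → K) (p : MvPolynomial σ K) (w : S) :
    MvPolynomial.aeval y p w = MvPolynomial.eval (fun i => y i w) p := by
  induction p using MvPolynomial.induction_on with
  | C a => simp
  | add p q hp hq => simp [hp, hq]
  | mul_X p i hp => simp [hp]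

theorem isOpen_setOf_ne_zero {f : W → K} (hf : f ∈ vectorSpacePolynomials K W) :
    IsOpen[zariskiTopology K W] {w | f w ≠ 0} := by
  obtain ⟨p, rfl⟩ := hf
  refine TopologicalSpace.isOpen_generateFrom_of_mem ⟨p, ?_⟩
  ext w
  simp [aeval_fun_apply]

theorem isOpen_preimage_linearMap (L : W →ₗ[K] W') {O : Set W'}
    (hO : IsOpen[zariskiTopology K W'] O) : IsOpen[zariskiTopology K W] (L ⁻¹' O) := by
  let _ := zariskiTopology K W
  let _ := zariskiTopology K W'
  have : Continuous L := by
    refine continuous_generateFrom_iff.mpr ?_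
    rintro _ ⟨p, rfl⟩
    refine TopologicalSpace.isOpen_generateFrom_of_mem
      ⟨MvPolynomial.rename (fun f => f.comp L) p, ?_⟩
    ext w
    simp only [Set.mem_ofPred_eq, MvPolynomial.eval_rename, Set.mem_preimage]
    rfl
  exact hO.preimage this

/-- A line through a point of a Zariski open set has only finitely many points outside of it. -/
theorem finite_setOf_add_smul_notMem {O : Set W} (hO : IsOpen[zariskiTopology K W] O)
    (w₀ w₁ : W) (h : w₀ ∈ O) : {t : K | w₀ + t • w₁ ∉ O}.Finite := by
  induction hO with
  | basic s hs =>
    obtain ⟨p, rfl⟩ := hs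
    let q : Polynomial K := MvPolynomial.aeval
      (fun f : Module.Dual K W => Polynomial.C (f w₀) + Polynomial.X * Polynomial.C (f w₁)) p
    have hq : ∀ t, q.eval t = MvPolynomial.eval (fun f : Module.Dual K W => f (w₀ + t • w₁)) p := by
      intro t
      have : (Polynomial.aeval t).comp (MvPolynomial.aeval (fun f : Module.Dual K W =>
          Polynomial.C (f w₀) + Polynomial.X * Polynomial.C (f w₁))) =
          MvPolynomial.aeval (fun f : Module.Dual K W => f (w₀ + t • w₁)) := by
        ext f
        simp
        ring
      have h' := DFunLike.congr_fun this p
      rwa [AlgHom.comp_apply, Polynomial.coe_aeval_eq_eval, MvPolynomial.aeval_eq_eval] at h'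
    have hq0 : q ≠ 0 := by
      rintro hq0
      have := hq 0
      simp [hq0] at this
      exact h this.symm
    refine (Polynomial.finite_setOfPred_isRoot hq0).subset fun t ht => ?_
    simp only [Set.mem_ofPred_eq, not_not] at ht
    exact (hq t).trans ht
  | univ => simp
  | inter s t _ _ hs ht =>
    refine ((hs h.1).union (ht h.2)).subset fun x hx => ?_
    simp only [Set.mem_inter_iff, Set.mem_ofPred_eq, not_and_or] at hx
    exact hx
  | sUnion S _ hS =>
    obtain ⟨s, hs, hws⟩ := h
    exact (hS s hs hws).subset fun t ht hts => ht ⟨s, hs, hts⟩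

/-- Clearing the common denominator `D` turns a polynomial in fractions into a member of `P`, with
the same zeros where `D` does not vanish. -/
theorem exists_mul_pow_eq_eval_div {σ S : Type*} (P : Subalgebra K (S → K)) {D : S → K}
    (hD : D ∈ P) {y : σ → S → K} (hy : ∀ i, y i ∈ P) (p : MvPolynomial σ K) :
    ∃ N : ℕ, ∃ q ∈ P, ∀ w, D w ≠ 0 →
      q w = D w ^ N * MvPolynomial.eval (fun i => y i w / D w) p := by
  induction p using MvPolynomial.induction_on with
  | C a => exact ⟨0, _, P.algebraMap_mem a, fun w _ => by simp⟩
  | add p p' hp hp' =>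
    obtain ⟨N, q, hq, h⟩ := hp
    obtain ⟨N', q', hq', h'⟩ := hp'
    refine ⟨N + N', D ^ N' * q + D ^ N * q', P.add_mem (P.mul_mem (P.pow_mem hD _) hq)
      (P.mul_mem (P.pow_mem hD _) hq'), fun w hw => ?_⟩
    simp only [Pi.add_apply, Pi.mul_apply, Pi.pow_apply, map_add, h w hw, h' w hw]
    ring
  | mul_X p i hp =>
    obtain ⟨N, q, hq, h⟩ := hp
    refine ⟨N + 1, q * y i, P.mul_mem hq (hy i), fun w hw => ?_⟩
    simp only [Pi.mul_apply, map_mul, MvPolynomial.eval_X, h w hw]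
    field_simp
    ring

theorem det_mem_subalgebra {S ι : Type*} [Fintype ι] [DecidableEq ι] {P : Subalgebra K (S → K)}
    {A : S → Matrix ι ι K} (hA : ∀ i j, (fun w => A w i j) ∈ P) : (fun w => (A w).det) ∈ P := by
  have : (fun w => (A w).det) =
      ∑ σ : Equiv.Perm ι, algebraMap K (S → K) (Equiv.Perm.sign σ : ℤ) *
        ∏ i, fun w => A w (σ i) i := by
    ext w
    simp [Matrix.det_apply']
  rw [this]
  exact P.sum_mem fun σ _ => P.mul_mem (P.algebraMap_mem _) (P.prod_mem fun i _ => hA _ _)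

theorem adjugate_mem_subalgebra {S ι : Type*} [Fintype ι] [DecidableEq ι]
    {P : Subalgebra K (S → K)} {A : S → Matrix ι ι K} (hA : ∀ i j, (fun w => A w i j) ∈ P)
    (i j : ι) : (fun w => (A w).adjugate i j) ∈ P := by
  simp only [Matrix.adjugate_apply]
  refine det_mem_subalgebra fun i' j' => ?_
  by_cases h : i' = j
  · subst h
    simp only [Matrix.updateRow_self]
    exact P.algebraMap_mem (Pi.single (M := fun _ => K) i 1 j')
  · simpa [Matrix.updateRow_apply, h] using hA i' j'

end ZariskiTopology

/-! ### Linear automorphisms and bases acting on flags -/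

namespace CompleteFlag

variable {K V : Type*} [Field K] [AddCommGroup V] [Module K V] {n : ℕ}

/-- The action of a linear automorphism on flags. -/
def map (g : V ≃ₗ[K] V) (F : CompleteFlag K V n) : CompleteFlag K V n where
  space i := (F.space i).map (g : V →ₗ[K] V)
  mono _ _ h := Submodule.map_mono (F.mono h)
  finrank_space i := by rw [LinearEquiv.finrank_map_eq, F.finrank_space]
  top := by simp [F.top]

theorem map_mem_map_space {g : V ≃ₗ[K] V} {F : CompleteFlag K V n} {k : Fin (n + 1)} {v : V} :
    g v ∈ (F.map g).space k ↔ v ∈ F.space k := by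
  simp [map]

theorem map_ofBasis (g : V ≃ₗ[K] V) (b : Module.Basis (Fin n) K V) :
    (ofBasis b).map g = ofBasis (b.map g) := by
  ext1
  funext k
  simp only [map, ofBasis, Module.Basis.flag, Submodule.map_span, ← Set.image_comp]
  rfl

theorem map_map (g g' : V ≃ₗ[K] V) (F : CompleteFlag K V n) :
    (F.map g).map g' = F.map (g.trans g') := by
  ext1
  funext k
  simp only [map, ← Submodule.map_comp]
  rfl

theorem map_refl (F : CompleteFlag K V n) : F.map (LinearEquiv.refl K V) = F := by
  ext1
  funext k
  exact Submodule.map_id _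

theorem map_map_symm (g : V ≃ₗ[K] V) (F : CompleteFlag K V n) : (F.map g).map g.symm = F := by
  rw [map_map, LinearEquiv.self_trans_symm, map_refl]

theorem mem_ofBasis_space {b : Module.Basis (Fin n) K V} {k : Fin (n + 1)} {v : V} :
    v ∈ (ofBasis b).space k ↔ ∀ i : Fin n, k ≤ i.castSucc → b.repr v i = 0 := by
  change v ∈ Submodule.span K _ ↔ _
  rw [Module.Basis.mem_span_image]
  constructor
  · intro h i hi
    by_contra hne
    exact absurd (h (Finsupp.mem_support_iff.mpr hne)) (not_lt.mpr hi)
  · intro h i hi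
    by_contra hne
    exact (Finsupp.mem_support_iff.mp hi) (h i (not_lt.mp hne))

theorem basis_mem_ofBasis_space {b : Module.Basis (Fin n) K V} {k : Fin (n + 1)} {i : Fin n} :
    b i ∈ (ofBasis b).space k ↔ i.castSucc < k :=
  b.self_mem_flag_iff

/-- Vectors lying in the successive differences of a flag form a basis adapted to it. -/
theorem exists_basis_of_mem_of_notMem [FiniteDimensional K V] (F : CompleteFlag K V n)
    (v : Fin n → V) (h : ∀ k, v k ∈ F.space k.succ) (h' : ∀ k, v k ∉ F.space k.castSucc) :
    ∃ b : Module.Basis (Fin n) K V, ⇑b = v ∧ ofBasis b = F := by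
  have hli : LinearIndependent K v := by
    rw [Fintype.linearIndependent_iff]
    intro c hc
    by_contra! hne
    -- Solving the relation for its last vector would place `v i` in the previous subspace.
    obtain ⟨i, hi, hmax⟩ := (Set.toFinite {i | c i ≠ 0}).exists_maximalFor id _ hne
    refine h' i ?_
    have h1 : v i = -(c i)⁻¹ • ∑ j ∈ Finset.univ.erase i, c j • v j := by
      rw [← Finset.add_sum_erase _ _ (Finset.mem_univ i)] at hc
      rw [eq_neg_of_add_eq_zero_right hc, smul_neg, neg_smul, neg_neg, smul_smul,
        inv_mul_cancel₀ hi, one_smul]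
    rw [h1]
    refine Submodule.smul_mem _ _ (Submodule.sum_mem _ fun j hj => ?_)
    by_cases hcj : c j = 0
    · simp [hcj]
    · refine Submodule.smul_mem _ _ (F.mono ?_ (h j))
      have hji : j ≠ i := Finset.ne_of_mem_erase hj
      have : j < i := by
        by_contra hlt
        exact hji (le_antisymm (hmax hcj (not_lt.mp hlt)) (not_lt.mp hlt))
      exact Fin.succ_le_castSucc_iff.mpr this
  have hcard : Fintype.card (Fin n) = Module.finrank K V := by
    rw [← finrank_top, ← F.top, F.finrank_space]
    simp
  refine ⟨Module.Basis.mk hli (hli.span_eq_top_of_card_eq_finrank' hcard).ge,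
    Module.Basis.coe_mk _ _, ?_⟩
  ext1
  funext k
  refine Submodule.eq_of_le_of_finrank_eq ?_ (by rw [F.finrank_space, finrank_space])
  refine (Module.Basis.flag_le_iff _).mpr fun i hi => ?_
  rw [Module.Basis.mk_apply]
  exact F.mono (Fin.castSucc_lt_iff_succ_le.mp hi) (h i)

theorem exists_mem_notMem [FiniteDimensional K V] (F : CompleteFlag K V n) (k : Fin n) :
    ∃ v ∈ F.space k.succ, v ∉ F.space k.castSucc := by
  refine Set.not_subset.mp fun hle => ?_
  have := Submodule.finrank_mono (show F.space k.succ ≤ F.space k.castSucc from hle)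
  simp [F.finrank_space] at this

theorem exists_ofBasis_eq [FiniteDimensional K V] (F : CompleteFlag K V n) :
    ∃ b : Module.Basis (Fin n) K V, ofBasis b = F := by
  choose v hv hv' using F.exists_mem_notMem
  obtain ⟨b, -, hb⟩ := F.exists_basis_of_mem_of_notMem v hv hv'
  exact ⟨b, hb⟩

theorem isOpen_iff {U : Set (CompleteFlag K V n)} :
    IsOpen U ↔ ∃ O : Set (Fin n → V), IsOpen[zariskiTopology K (Fin n → V)] O ∧
      ∀ b : Module.Basis (Fin n) K V, ⇑b ∈ O ↔ ofBasis b ∈ U := by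
  let _ := zariskiTopology K (Fin n → V)
  rw [isOpen_coinduced, isOpen_induced_iff]
  simp only [Set.ext_iff, Set.mem_preimage]

theorem isOpen_preimage_map (g : V ≃ₗ[K] V) {U : Set (CompleteFlag K V n)} (hU : IsOpen U) :
    IsOpen (map g ⁻¹' U) := by
  obtain ⟨O, hO, h⟩ := isOpen_iff.mp hU
  refine isOpen_iff.mpr ⟨_, isOpen_preimage_linearMap
    (LinearMap.compLeft (g : V →ₗ[K] V) (Fin n)) hO, fun b => ?_⟩
  rw [Set.mem_preimage, Set.mem_preimage, map_ofBasis, ← h]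
  rfl

/-- An affine line of bases which starts in an open set of flags leaves it only finitely often. -/
theorem finite_setOf_ofBasis_notMem {U : Set (CompleteFlag K V n)} (hU : IsOpen U)
    {b : Module.Basis (Fin n) K V} (hb : ofBasis b ∈ U) (w : Fin n → V) :
    {t : K | ∃ b' : Module.Basis (Fin n) K V,
      (∀ i, b' i = b i + t • w i) ∧ ofBasis b' ∉ U}.Finite := by
  obtain ⟨O, hO, h⟩ := isOpen_iff.mp hU
  refine (finite_setOf_add_smul_notMem hO (⇑b) w ((h b).mpr hb)).subset ?_
  rintro t ⟨b', hb', hU'⟩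
  have : ⇑b' = ⇑b + t • w := funext hb'
  rwa [← h, this] at hU'

/-- For `t ≠ 0`, `g + t h` is singular exactly when `-t⁻¹` is in the finite spectrum of `g⁻¹ h`. -/
theorem finite_setOf_not_isUnit_add_smul [FiniteDimensional K V] (g : V ≃ₗ[K] V)
    (h : Module.End K V) : {t : K | ¬ IsUnit ((g : Module.End K V) + t • h)}.Finite := by
  have hfin := Module.End.finite_spectrum ((g.symm : Module.End K V) * h)
  refine ((hfin.image fun x => -x⁻¹)).subset fun t ht => ?_
  have hg : (g : Module.End K V) * (g.symm : Module.End K V) = 1 := by ext; simp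
  have hgu : IsUnit (g : Module.End K V) := (Module.End.isUnit_iff _).mpr g.bijective
  have ht0 : t ≠ 0 := by
    rintro rfl
    exact ht (by simpa using hgu)
  refine ⟨-t⁻¹, ?_, by simp⟩
  rw [spectrum.mem_iff]
  intro hu
  refine ht ?_
  have : (g : Module.End K V) + t • h = (-t) • ((g : Module.End K V) *
      (algebraMap K (Module.End K V) (-t⁻¹) - (g.symm : Module.End K V) * h)) := by
    rw [mul_sub, ← mul_assoc, hg, one_mul, Algebra.algebraMap_eq_smul_one, mul_smul_comm, mul_one,
      smul_sub, smul_smul]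
    simp [ht0]
  rw [this]
  have := (hgu.mul hu)
  exact this.smul (Units.mk0 (-t) (neg_ne_zero.mpr ht0))

end CompleteFlag

/-! ### Affine charts of the flag variety -/

namespace CompleteFlag

variable {K V : Type*} [Field K] [AddCommGroup V] [Module K V] {n : ℕ}

theorem HasCoordinates.map {F : CompleteFlag K V n} {b : Module.Basis (Fin n) K V}
    {x : {p : Fin n × Fin n // p.1 < p.2} → K} (h : F.HasCoordinates b x) (g : V ≃ₗ[K] V) :
    (F.map g).HasCoordinates (b.map g) x := by
  obtain ⟨f, hf, rfl⟩ := h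
  refine ⟨f.map g, fun i => ?_, map_ofBasis g f⟩
  simp [hf, map_sum]

/-- The first basis vectors projected to the span of the first vectors of a reference basis. -/
noncomputable def leadingMatrix (b : Module.Basis (Fin n) K V) (k : Fin (n + 1)) (w : Fin n → V) :
    Matrix {i : Fin n // i.castSucc < k} {i : Fin n // i.castSucc < k} K :=
  Matrix.of fun i l => b.coord i (w l)

/-- `F` is transversal to the flags opposite to the flag of `b`. -/
def IsTransversal (F : CompleteFlag K V n) (b : Module.Basis (Fin n) K V) : Prop :=
  ∀ k, ∀ v ∈ F.space k, (∀ i : Fin n, i.castSucc < k → b.coord i v = 0) → v = 0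

theorem mem_ofBasis_space_iff_exists_sum {f : Module.Basis (Fin n) K V} {k : Fin (n + 1)} {v : V} :
    v ∈ (ofBasis f).space k ↔ ∃ c : {i : Fin n // i.castSucc < k} → K, ∑ l, c l • f l = v := by
  change v ∈ Submodule.span K (f '' {i | i.castSucc < k}) ↔ _
  rw [Set.image_eq_range, Submodule.mem_span_range_iff_exists_fun]
  rfl

theorem leadingMatrix_mulVec (b : Module.Basis (Fin n) K V) (k : Fin (n + 1)) (w : Fin n → V)
    (c : {i : Fin n // i.castSucc < k} → K) (i : {i : Fin n // i.castSucc < k}) :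
    (leadingMatrix b k w).mulVec c i = b.coord i (∑ l, c l • w l) := by
  simp [leadingMatrix, Matrix.mulVec, dotProduct, mul_comm]

theorem isTransversal_ofBasis_iff {f b : Module.Basis (Fin n) K V} :
    (ofBasis f).IsTransversal b ↔ ∀ k, (leadingMatrix b k f).det ≠ 0 := by
  refine forall_congr' fun k => ?_
  rw [Ne, ← Matrix.exists_mulVec_eq_zero_iff]
  constructor
  · rintro h ⟨c, hc, hM⟩
    have := h _ (mem_ofBasis_space_iff_exists_sum.mpr ⟨c, rfl⟩) fun i hi => by
      rw [← leadingMatrix_mulVec b k f c ⟨i, hi⟩, hM]; rfl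
    have hli := f.linearIndependent.comp
      (Subtype.val : {i : Fin n // i.castSucc < k} → Fin n) Subtype.val_injective
    exact hc (funext (Fintype.linearIndependent_iff.mp hli c this))
  · intro h v hv hv'
    obtain ⟨c, rfl⟩ := mem_ofBasis_space_iff_exists_sum.mp hv
    by_cases hc : c = 0
    · simp [hc]
    · refine absurd ⟨c, hc, ?_⟩ h
      ext i
      rw [leadingMatrix_mulVec]
      exact hv' i i.2

theorem coord_chart_vector {b : Module.Basis (Fin n) K V}
    (x : {p : Fin n × Fin n // p.1 < p.2} → K) (i k : Fin n) :
    b.coord k (b i + ∑ j : {j : Fin n // i < j}, x ⟨(i, j.1), j.2⟩ • b j.1) =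
      if h : i < k then x ⟨(i, k), h⟩ else if i = k then 1 else 0 := by
  simp only [map_add, map_sum, map_smul, Module.Basis.coord_apply, Module.Basis.repr_self,
    smul_eq_mul, Finsupp.single_apply]
  by_cases h : i < k
  · rw [dif_pos h, if_neg h.ne, zero_add, Finset.sum_eq_single ⟨k, h⟩]
    · simp
    · intro j _ hj
      rw [if_neg (fun h => hj (Subtype.ext h)), mul_zero]
    · simp
  · rw [dif_neg h, Finset.sum_eq_zero, add_zero]
    intro j _
    rw [if_neg (fun h' : j.1 = k => h (h' ▸ j.2)), mul_zero]

/-- By unitriangularity, the first nonzero coefficient of `v` in the basis `f` is also its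
coordinate on the corresponding `b i`. -/
theorem HasCoordinates.isTransversal {F : CompleteFlag K V n} {b : Module.Basis (Fin n) K V}
    {x : {p : Fin n × Fin n // p.1 < p.2} → K} (h : F.HasCoordinates b x) :
    F.IsTransversal b := by
  obtain ⟨f, hf, rfl⟩ := h
  intro k v hv hv'
  by_contra hne
  have hne' : {i | f.repr v i ≠ 0}.Nonempty := by
    by_contra hem
    refine hne (f.repr.map_eq_zero_iff.mp (Finsupp.ext fun i => ?_))
    by_contra hi
    exact hem ⟨i, hi⟩
  obtain ⟨i, hi, hmin⟩ := (Set.toFinite {i | f.repr v i ≠ 0}).exists_minimalFor id _ hne'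
  have hik : i.castSucc < k := by
    by_contra hlt
    exact hi (mem_ofBasis_space.mp hv i (not_lt.mp hlt))
  refine hi ?_
  have h1 := hv' i hik
  rw [← f.sum_repr v, map_sum, Finset.sum_eq_single i] at h1
  · rw [map_smul, hf, coord_chart_vector] at h1
    simpa using h1
  · intro j _ hji
    rw [map_smul, hf, coord_chart_vector]
    rcases lt_or_gt_of_ne hji with hlt | hgt
    · have : f.repr v j = 0 := by
        by_contra hj
        exact absurd (hmin hj hlt.le) (not_le.mpr hlt)
      simp [this]
    · simp [not_lt.mpr hgt.le, hji]
  · simp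

/-- The coordinates of a flag in a chart are unique. -/
theorem HasCoordinates.unique {F : CompleteFlag K V n} {b : Module.Basis (Fin n) K V}
    {x y : {p : Fin n × Fin n // p.1 < p.2} → K} (hx : F.HasCoordinates b x)
    (hy : F.HasCoordinates b y) : x = y := by
  have ht := hx.isTransversal
  obtain ⟨f, hf, hfF⟩ := hx
  obtain ⟨f', hf', hfF'⟩ := hy
  have key : ∀ i, f i = f' i := by
    intro i
    rw [← sub_eq_zero]
    refine ht i.succ _ (sub_mem ?_ ?_) fun k hk => ?_
    · rw [hfF, basis_mem_ofBasis_space]; exact Fin.castSucc_lt_succ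
    · rw [hfF', basis_mem_ofBasis_space]; exact Fin.castSucc_lt_succ
    · have : ¬ i < k := not_lt.mpr (Fin.castSucc_lt_succ_iff.mp hk)
      rw [map_sub, hf, hf', coord_chart_vector, coord_chart_vector]
      simp [this]
  ext ⟨⟨i, j⟩, hij⟩
  have := congrArg (b.coord j) (key i)
  rw [hf, hf', coord_chart_vector, coord_chart_vector] at this
  simpa [show i < j from hij] using this

/-- A vector in the span of the first `k + 1` members of a family whose first `k + 1` coordinates
are `0, ..., 0, det`, where `det` is the leading minor. -/
noncomputable def cramerVector (b : Module.Basis (Fin n) K V) (k : Fin n) (w : Fin n → V) : V :=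
  ∑ l : {i : Fin n // i.castSucc < k.succ},
    (leadingMatrix b k.succ w).adjugate l ⟨k, Fin.castSucc_lt_succ⟩ • w l

theorem coord_cramerVector (b : Module.Basis (Fin n) K V) (k : Fin n) (w : Fin n → V)
    {i : Fin n} (hi : i ≤ k) :
    b.coord i (cramerVector b k w) = if i = k then (leadingMatrix b k.succ w).det else 0 := by
  have hi' : i.castSucc < k.succ := Fin.castSucc_lt_succ_iff.mpr hi
  rw [cramerVector, ← leadingMatrix_mulVec b k.succ w
    (fun l => (leadingMatrix b k.succ w).adjugate l ⟨k, Fin.castSucc_lt_succ⟩) ⟨i, hi'⟩]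
  change ((leadingMatrix b k.succ w) * (leadingMatrix b k.succ w).adjugate) ⟨i, hi'⟩
    ⟨k, Fin.castSucc_lt_succ⟩ = _
  rw [Matrix.mul_adjugate]
  simp [Matrix.one_apply]

/-- The Cramer vector divided by its leading minor has the normal form `b i` plus later terms, and
still belongs to the flag. -/
theorem hasCoordinates_of_det_ne_zero [FiniteDimensional K V] {f b : Module.Basis (Fin n) K V}
    (h : ∀ k, (leadingMatrix b k f).det ≠ 0) :
    (ofBasis f).HasCoordinates b fun p =>
      b.coord p.1.2 (cramerVector b p.1.1 f) / (leadingMatrix b p.1.1.succ f).det := by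
  set x : {p : Fin n × Fin n // p.1 < p.2} → K := fun p =>
      b.coord p.1.2 (cramerVector b p.1.1 f) / (leadingMatrix b p.1.1.succ f).det with hx
  have ht := isTransversal_ofBasis_iff.mpr h
  have hv : ∀ i, b i + ∑ j : {j : Fin n // i < j}, x ⟨(i, j.1), j.2⟩ • b j.1 =
      ((leadingMatrix b i.succ f).det)⁻¹ • cramerVector b i f := by
    intro i
    refine b.ext_elem fun k => ?_
    rw [← b.coord_apply, ← b.coord_apply, coord_chart_vector, map_smul, smul_eq_mul]
    split_ifs with h1 h2
    · exact div_eq_inv_mul _ _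
    · rw [coord_cramerVector b i f h2.ge, if_pos h2.symm, inv_mul_cancel₀ (h _)]
    · rw [coord_cramerVector b i f (not_lt.mp h1), if_neg (Ne.symm h2), mul_zero]
  obtain ⟨f', hf', hF⟩ := (ofBasis f).exists_basis_of_mem_of_notMem
    (fun i => b i + ∑ j : {j : Fin n // i < j}, x ⟨(i, j.1), j.2⟩ • b j.1) (fun i => by
      rw [hv]
      refine Submodule.smul_mem _ _ (Submodule.sum_mem _ fun l _ => Submodule.smul_mem _ _ ?_)
      exact basis_mem_ofBasis_space.mpr l.2) (fun i hi => by
      have h0 := ht _ _ hi fun k hk => by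
        have hk' : k < i := hk
        rw [coord_chart_vector]
        simp [not_lt.mpr hk'.le, hk'.ne']
      have h1 := coord_chart_vector (b := b) x i i
      rw [h0] at h1
      simp at h1)
  exact ⟨f', fun i => congrFun hf' i, hF.symm⟩

/-- On bases, the chart is the locus where all leading minors are nonzero, and the coordinates are
rational functions with these minors as denominators. -/
theorem isOpen_setOf_hasCoordinates_eval_ne_zero [FiniteDimensional K V]
    (b : Module.Basis (Fin n) K V) (p : MvPolynomial {p : Fin n × Fin n // p.1 < p.2} K) :
    IsOpen {F : CompleteFlag K V n | ∃ x, F.HasCoordinates b x ∧ MvPolynomial.eval x p ≠ 0} := by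
  set P := vectorSpacePolynomials K (Fin n → V)
  have hM : ∀ k i l, (fun w => leadingMatrix b k w i l) ∈ P := fun k i l =>
    dual_mem_vectorSpacePolynomials ((b.coord i).comp (LinearMap.proj (φ := fun _ => V) l.1))
  have hdet : ∀ k, (fun w => (leadingMatrix b k w).det) ∈ P := fun k =>
    det_mem_subalgebra (hM k)
  let D : (Fin n → V) → K := ∏ k, fun w => (leadingMatrix b k w).det
  have hDw : ∀ w, D w ≠ 0 ↔ ∀ k, (leadingMatrix b k w).det ≠ 0 := fun w => by
    simp [D, Finset.prod_apply, Finset.prod_ne_zero_iff]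
  have hD : D ∈ P := P.prod_mem fun k _ => hdet k
  -- Numerators over the common denominator `D`: each Cramer numerator is multiplied by all the
  -- other minors.
  let y : {p : Fin n × Fin n // p.1 < p.2} → (Fin n → V) → K := fun p =>
    (fun w => b.coord p.1.2 (cramerVector b p.1.1 w)) *
      ∏ k ∈ Finset.univ.erase p.1.1.succ, fun w => (leadingMatrix b k w).det
  have hy : ∀ p, y p ∈ P := fun p => by
    refine P.mul_mem ?_ (P.prod_mem fun k _ => hdet k)
    have : (fun w => b.coord p.1.2 (cramerVector b p.1.1 w)) =
        ∑ l : {i : Fin n // i.castSucc < p.1.1.succ},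
          (fun w => (leadingMatrix b p.1.1.succ w).adjugate l ⟨p.1.1, Fin.castSucc_lt_succ⟩) *
            fun w => b.coord p.1.2 (w l) := by
      ext w
      simp [cramerVector]
    rw [this]
    exact P.sum_mem fun l _ => P.mul_mem (adjugate_mem_subalgebra (hM _) _ _)
      (dual_mem_vectorSpacePolynomials ((b.coord p.1.2).comp (LinearMap.proj (φ := fun _ => V) l.1)))
  have hyD : ∀ p w, D w ≠ 0 → y p w / D w =
      b.coord p.1.2 (cramerVector b p.1.1 w) / (leadingMatrix b p.1.1.succ w).det := by
    intro p w hw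
    have h1 : D w = (leadingMatrix b p.1.1.succ w).det *
        (∏ k ∈ Finset.univ.erase p.1.1.succ, fun w => (leadingMatrix b k w).det) w := by
      simp only [D, Finset.prod_apply]
      rw [Finset.mul_prod_erase _ (fun k => (leadingMatrix b k w).det) (Finset.mem_univ _)]
    have h2 := hw
    rw [h1] at h2
    simp only [y, Pi.mul_apply]
    rw [h1, mul_div_mul_right _ _ (right_ne_zero_of_mul h2)]
  obtain ⟨N, q, hq, hqp⟩ := exists_mul_pow_eq_eval_div P hD hy p
  refine isOpen_iff.mpr ⟨_, isOpen_setOf_ne_zero (P.mul_mem hD hq), fun f => ?_⟩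
  simp only [Set.mem_ofPred_eq, Pi.mul_apply, mul_ne_zero_iff]
  have hx : D f ≠ 0 → (ofBasis f).HasCoordinates b fun i => y i f / D f := fun hDf => by
    have := hasCoordinates_of_det_ne_zero ((hDw f).mp hDf)
    simpa only [hyD _ _ hDf] using this
  constructor
  · rintro ⟨hDf, hqf⟩
    refine ⟨_, hx hDf, ?_⟩
    rw [hqp _ hDf] at hqf
    exact right_ne_zero_of_mul hqf
  · rintro ⟨x, hxF, hxp⟩
    have hDf := (hDw f).mpr (isTransversal_ofBasis_iff.mp hxF.isTransversal)
    refine ⟨hDf, ?_⟩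
    rw [hqp _ hDf, ← hxF.unique (hx hDf)]
    exact mul_ne_zero (pow_ne_zero _ hDf) hxp

end CompleteFlag

/-! ### Elementary degenerations and sorting of adapted bases -/

namespace CompleteFlag

variable {K V : Type*} [Field K] [AddCommGroup V] [Module K V] {n : ℕ}

/-- The orbit of `F` under the centralizer of `u` meets `U`. -/
def OrbitMeets (u : Module.End K V) (U : Set (CompleteFlag K V n)) (F : CompleteFlag K V n) :
    Prop :=
  ∃ g : V ≃ₗ[K] V, (∀ v, g (u v) = u (g v)) ∧ F.map g ∈ U

theorem OrbitMeets.of_map {u : Module.End K V} {U : Set (CompleteFlag K V n)}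
    {F : CompleteFlag K V n} {g : V ≃ₗ[K] V} (hg : ∀ v, g (u v) = u (g v))
    (h : OrbitMeets u U (F.map g)) : OrbitMeets u U F := by
  obtain ⟨g', hg', h⟩ := h
  refine ⟨g.trans g', fun v => ?_, by rwa [← map_map]⟩
  simp [hg, hg']

theorem ofBasis_space_map_eq [FiniteDimensional K V] {f : Module.Basis (Fin n) K V}
    {g : V ≃ₗ[K] V} {l : Fin (n + 1)} (h : ∀ k : Fin n, k.castSucc < l → g (f k) ∈ (ofBasis f).space l) :
    ((ofBasis f).map g).space l = (ofBasis f).space l := by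
  refine Submodule.eq_of_le_of_finrank_eq ?_ (by rw [finrank_space, finrank_space])
  refine Submodule.map_le_iff_le_comap.mpr ((Module.Basis.flag_le_iff _).mpr fun k hk => h k hk)

/-- An elementary degeneration: a flag spanned by a basis degenerates, along a one-parameter
family in the centralizer of `u`, to the flag of the basis with two vectors exchanged. -/
theorem OrbitMeets.of_swap [Infinite K] [FiniteDimensional K V] {u : Module.End K V}
    {U : Set (CompleteFlag K V n)} (hU : IsOpen U) {f : Module.Basis (Fin n) K V} {i j : Fin n}
    (hij : i < j) {h : Module.End K V} (hu : ∀ v, h (u v) = u (h v)) (hi : h (f i) = f j)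
    (h0 : ∀ k ≤ j, k ≠ i → h (f k) = 0)
    (h1 : ∀ k, j < k → h (f k) ∈ (ofBasis f).space k.succ)
    (hs : OrbitMeets u U (ofBasis (f.reindex (Equiv.swap i j)))) :
    OrbitMeets u U (ofBasis f) := by
  obtain ⟨g, hg, hgU⟩ := hs
  have hfin1 := finite_setOf_ofBasis_notMem (isOpen_preimage_map g hU) hgU (Pi.single i (f i))
  have hfin2 := (finite_setOf_not_isUnit_add_smul (LinearEquiv.refl K V) h).preimage
    (f := fun t : K => t⁻¹) inv_injective.injOn
  obtain ⟨t, ht⟩ := ((hfin1.union hfin2).union (Set.finite_singleton 0)).exists_notMem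
  simp only [Set.mem_union, Set.mem_singleton_iff, not_or, Set.mem_preimage, Set.mem_ofPred_eq,
    not_not, not_exists, not_and] at ht
  obtain ⟨⟨ht1, ht2⟩, ht0⟩ := ht
  -- The flag moved by `γ` is spanned by the exchanged basis, with `t • f i` added to the vector in
  -- place `i`: `f j + t • f i = γ (t • f i)` and `f i = γ (f i - t⁻¹ • f j)`. This is an affine
  -- line of bases through the exchanged one at `t = 0`.
  let γ : V ≃ₗ[K] V := LinearEquiv.ofBijective _ ((Module.End.isUnit_iff _).mp ht2)
  have hγ : ∀ v, γ v = v + t⁻¹ • h v := fun v => rfl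
  refine OrbitMeets.of_map (g := γ) (fun v => by simp [hγ, hu]) ⟨g, hg, ?_⟩
  have hspace : ∀ l : Fin (n + 1), j.castSucc < l →
      ((ofBasis f).map γ).space l = (ofBasis f).space l := by
    intro l hl
    refine ofBasis_space_map_eq fun k hk => ?_
    rw [hγ]
    refine add_mem (basis_mem_ofBasis_space.mpr hk) (Submodule.smul_mem _ _ ?_)
    by_cases hki : k = i
    · rw [hki, hi]
      exact basis_mem_ofBasis_space.mpr hl
    · by_cases hkj : k ≤ j
      · rw [h0 k hkj hki]
        exact Submodule.zero_mem _
      · exact (ofBasis f).mono (Fin.castSucc_lt_iff_succ_le.mp hk) (h1 k (not_le.mp hkj))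
  have hmem : ∀ k, f k ∈ (ofBasis f).space k.succ := fun k =>
    basis_mem_ofBasis_space.mpr Fin.castSucc_lt_succ
  have hnot : ∀ k, f k ∉ (ofBasis f).space k.castSucc := fun k hk =>
    lt_irrefl _ (basis_mem_ofBasis_space.mp hk)
  have key : ∀ k, (f.reindex (Equiv.swap i j)) k + t • (Pi.single i (f i) : Fin n → V) k ∈
      ((ofBasis f).map γ).space k.succ ∧
      (f.reindex (Equiv.swap i j)) k + t • (Pi.single i (f i) : Fin n → V) k ∉
      ((ofBasis f).map γ).space k.castSucc := by
    intro k
    rw [Module.Basis.reindex_apply, Equiv.symm_swap]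
    by_cases hki : k = i
    · subst hki
      have : f (Equiv.swap k j k) + t • (Pi.single k (f k) : Fin n → V) k = γ (t • f k) := by
        simp [hγ, hi, ht0, smul_smul, add_comm]
      rw [this, map_mem_map_space, map_mem_map_space, Submodule.smul_mem_iff _ ht0,
        Submodule.smul_mem_iff _ ht0]
      exact ⟨hmem k, hnot k⟩
    by_cases hkj : k = j
    · subst hkj
      have : f (Equiv.swap i k k) + t • (Pi.single i (f i) : Fin n → V) k =
          γ (f i - t⁻¹ • f k) := by
        simp [hγ, hi, hki, h0 k le_rfl hki]
      have hik : f i ∈ (ofBasis f).space k.castSucc := basis_mem_ofBasis_space.mpr hij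
      rw [this, map_mem_map_space, map_mem_map_space]
      refine ⟨sub_mem ((ofBasis f).mono (Fin.castSucc_lt_succ).le hik)
        (Submodule.smul_mem _ _ (hmem k)), fun hc => hnot k ?_⟩
      have := (Submodule.sub_mem_iff_right _ hik).mp hc
      rwa [Submodule.smul_mem_iff _ (inv_ne_zero ht0)] at this
    have hk : f (Equiv.swap i j k) + t • (Pi.single i (f i) : Fin n → V) k = f k := by
      rw [Equiv.swap_apply_of_ne_of_ne hki hkj]
      simp [hki]
    rw [hk]
    by_cases hlt : k ≤ j
    · have : f k = γ (f k) := by simp [hγ, h0 k hlt hki]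
      rw [this, map_mem_map_space, map_mem_map_space]
      exact ⟨hmem k, hnot k⟩
    · have hjk : j < k := not_le.mp hlt
      rw [hspace k.succ (Fin.castSucc_lt_castSucc_iff.mpr hjk |>.trans Fin.castSucc_lt_succ),
        hspace k.castSucc (Fin.castSucc_lt_castSucc_iff.mpr hjk)]
      exact ⟨hmem k, hnot k⟩
  obtain ⟨b', hb', hF⟩ := ((ofBasis f).map γ).exists_basis_of_mem_of_notMem _
    (fun k => (key k).1) (fun k => (key k).2)
  rw [← hF]
  exact ht1 b' fun k => congrFun hb' k

/-- The chain `A` of subspaces is adapted to the basis `f`, with levels `ℓ`. -/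
def IsAdapted (f : Module.Basis (Fin n) K V) (ℓ : Fin n → ℕ) (A : ℕ → Submodule K V) : Prop :=
  ∀ j, A j = Submodule.span K (f '' {i | ℓ i ≤ j})

theorem IsAdapted.mem_iff {f : Module.Basis (Fin n) K V} {ℓ : Fin n → ℕ} {A : ℕ → Submodule K V}
    (h : IsAdapted f ℓ A) {j : ℕ} {v : V} : v ∈ A j ↔ ∀ i, f.repr v i ≠ 0 → ℓ i ≤ j := by
  rw [h j, Module.Basis.mem_span_image]
  simp [Set.subset_def]

theorem IsAdapted.basis_mem_iff {f : Module.Basis (Fin n) K V} {ℓ : Fin n → ℕ}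
    {A : ℕ → Submodule K V} (h : IsAdapted f ℓ A) {j : ℕ} {i : Fin n} : f i ∈ A j ↔ ℓ i ≤ j := by
  rw [h j, Module.Basis.self_mem_span_image]
  rfl

theorem IsAdapted.reindex {f : Module.Basis (Fin n) K V} {ℓ : Fin n → ℕ}
    {A : ℕ → Submodule K V} (h : IsAdapted f ℓ A) (σ : Equiv.Perm (Fin n)) :
    IsAdapted (f.reindex σ) (ℓ ∘ σ.symm) A := by
  intro j
  rw [h j]
  congr 1
  ext v
  constructor
  · rintro ⟨i, hi, rfl⟩
    exact ⟨σ i, by simpa using hi, by simp⟩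
  · rintro ⟨i, hi, rfl⟩
    exact ⟨σ.symm i, hi, by simp⟩

/-- Every flag is spanned by a basis adapted to a given chain of subspaces. -/
theorem exists_isAdapted [FiniteDimensional K V] (F : CompleteFlag K V n)
    {A : ℕ → Submodule K V} (hA : Monotone A) {m : ℕ} (hm : A m = ⊤) :
    ∃ (f : Module.Basis (Fin n) K V) (ℓ : Fin n → ℕ), ofBasis f = F ∧ IsAdapted f ℓ A := by
  classical
  have hex : ∀ i : Fin n, ∃ j, ∃ v ∈ A j, v ∈ F.space i.succ ∧ v ∉ F.space i.castSucc := fun i => by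
    obtain ⟨v, hv, hv'⟩ := F.exists_mem_notMem i
    exact ⟨m, v, hm ▸ Submodule.mem_top, hv, hv'⟩
  -- Vectors of least possible level: a vector of `A j` first appearing at step `k` then forces the
  -- level of `f k` to be at most `j`, so a multiple of `f k` can be subtracted without leaving `A
  -- j`.
  choose v hvA hv hv' using fun i => Nat.find_spec (hex i)
  obtain ⟨f, rfl, rfl⟩ := F.exists_basis_of_mem_of_notMem v hv hv'
  refine ⟨f, fun i => Nat.find (hex i), rfl, fun j => le_antisymm ?_ ?_⟩
  · have key : ∀ k : Fin (n + 1), ∀ v ∈ A j, v ∈ (ofBasis f).space k →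
        v ∈ Submodule.span K (f '' {i | Nat.find (hex i) ≤ j}) := by
      intro k
      induction k using Fin.induction with
      | zero =>
        intro v _ hv0
        have : v = 0 := f.repr.map_eq_zero_iff.mp
          (Finsupp.ext fun i => mem_ofBasis_space.mp hv0 i (Fin.zero_le _))
        rw [this]
        exact Submodule.zero_mem _
      | succ k ih =>
        intro v hvj hvk
        by_cases hvk' : v ∈ (ofBasis f).space k.castSucc
        · exact ih v hvj hvk'
        · have hkj : Nat.find (hex k) ≤ j := Nat.find_min' _ ⟨v, hvj, hvk, hvk'⟩
          have hfk : f k ∈ Submodule.span K (f '' {i | Nat.find (hex i) ≤ j}) :=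
            Submodule.subset_span ⟨k, hkj, rfl⟩
          have h1 := ih (v - f.repr v k • f k)
            (sub_mem hvj (Submodule.smul_mem _ _ (hA hkj (hvA k)))) (by
              rw [mem_ofBasis_space] at hvk ⊢
              intro i hi
              rcases eq_or_lt_of_le (Fin.castSucc_le_castSucc_iff.mp hi) with rfl | hlt
              · simp
              · have := hvk i (Fin.succ_le_castSucc_iff.mpr hlt)
                simp [this, hlt.ne])
          have h2 := add_mem h1 (Submodule.smul_mem _ (f.repr v k) hfk)
          rwa [sub_add_cancel] at h2
    intro v hv
    exact key (Fin.last n) v hv ((ofBasis f).top ▸ Submodule.mem_top)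
  · rw [Submodule.span_le]
    rintro _ ⟨i, hi, rfl⟩
    exact hA hi (hvA i)

/-- Bubble sort: only inversions of the levels are exchanged, so a property preserved by these
exchanges survives until the levels are sorted. -/
theorem IsAdapted.exists_monotone {A : ℕ → Submodule K V} {R : Module.Basis (Fin n) K V → Prop}
    (hR : ∀ f ℓ i j, IsAdapted f ℓ A → i < j → ℓ j < ℓ i → R f →
      R (f.reindex (Equiv.swap i j)))
    {f : Module.Basis (Fin n) K V} {ℓ : Fin n → ℕ} (h : IsAdapted f ℓ A) (hf : R f) :
    ∃ f' ℓ', Monotone ℓ' ∧ IsAdapted f' ℓ' A ∧ R f' := by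
  have := Tuple.bubble_sort_induction (f := ℓ) (P := fun m => ∃ f', IsAdapted f' m A ∧ R f')
    ⟨f, h, hf⟩ (by
      rintro m i j hij hm ⟨f', hf', hRf'⟩
      refine ⟨f'.reindex (Equiv.swap i j), ?_, hR f' m i j hf' hij hm hRf'⟩
      simpa using hf'.reindex (Equiv.swap i j))
  obtain ⟨f', hf', hRf'⟩ := this
  exact ⟨f', _, Tuple.monotone_sort ℓ, hf', hRf'⟩

theorem IsAdapted.eq_space [FiniteDimensional K V] {f : Module.Basis (Fin n) K V} {ℓ : Fin n → ℕ}
    {A : ℕ → Submodule K V} (h : IsAdapted f ℓ A) (hℓ : Monotone ℓ) {j : ℕ} {k : Fin (n + 1)}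
    (hk : Module.finrank K (A j) = k) : (ofBasis f).space k = A j := by
  by_cases hc : ∀ i : Fin n, ℓ i ≤ j → i.castSucc < k
  · refine (Submodule.eq_of_le_of_finrank_eq ?_ (by rw [hk, finrank_space])).symm
    rw [h j, Submodule.span_le]
    rintro _ ⟨i, hi, rfl⟩
    exact basis_mem_ofBasis_space.mpr (hc i hi)
  · push Not at hc
    obtain ⟨i, hi, hki⟩ := hc
    refine Submodule.eq_of_le_of_finrank_eq ?_ (by rw [hk, finrank_space])
    refine (Module.Basis.flag_le_iff _).mpr fun i' hi' => h.basis_mem_iff.mpr ?_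
    exact (hℓ (Fin.castSucc_lt_castSucc_iff.mp (hi'.trans_le hki)).le).trans hi

end CompleteFlag

/-! ### Degeneration of every flag to the standard flag -/

namespace CompleteFlag

variable {K V : Type*} [Field K] [AddCommGroup V] [Module K V]

theorem ofBasis_reindex_swap_space [FiniteDimensional K V] {n : ℕ} {f : Module.Basis (Fin n) K V}
    {i j : Fin n} (hij : i < j) {l : Fin (n + 1)} (hl : j.castSucc < l) :
    (ofBasis (f.reindex (Equiv.swap i j))).space l = (ofBasis f).space l := by
  refine Submodule.eq_of_le_of_finrank_eq ((Module.Basis.flag_le_iff _).mpr fun k hk => ?_)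
    (by rw [finrank_space, finrank_space])
  rw [Module.Basis.reindex_apply, Equiv.symm_swap, basis_mem_ofBasis_space]
  by_cases hki : k = i
  · rwa [hki, Equiv.swap_apply_left]
  by_cases hkj : k = j
  · rw [hkj, Equiv.swap_apply_right]
    exact (Fin.castSucc_lt_castSucc_iff.mpr hij).trans hl
  · rwa [Equiv.swap_apply_of_ne_of_ne hki hkj]

/-- A flag degenerates to one which passes through the image and the kernel of `u`. -/
theorem exists_space_eq_range_ker [Infinite K] [FiniteDimensional K V] {n : ℕ}
    {u : Module.End K V} (huu : ∀ v, u (u v) = 0) {s r : Fin (n + 1)}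
    (hs : Module.finrank K (LinearMap.range u) = s) (hr : Module.finrank K (LinearMap.ker u) = r)
    {U : Set (CompleteFlag K V n)} (hU : IsOpen U) (F : CompleteFlag K V n) :
    ∃ G : CompleteFlag K V n, (OrbitMeets u U G → OrbitMeets u U F) ∧
      G.space s = LinearMap.range u ∧ G.space r = LinearMap.ker u := by
  have hle : LinearMap.range u ≤ LinearMap.ker u := by
    rintro _ ⟨v, rfl⟩
    exact huu v
  let A : ℕ → Submodule K V := fun j =>
    if j = 0 then LinearMap.range u else if j = 1 then LinearMap.ker u else ⊤
  have hA : Monotone A := by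
    refine monotone_nat_of_le_succ fun j => ?_
    rcases j with _ | _ | j
    · exact hle
    · exact le_top
    · exact le_rfl
  obtain ⟨f, ℓ, rfl, hf⟩ := exists_isAdapted F hA (m := 2) rfl
  obtain ⟨f', ℓ', hℓ', hf', hR⟩ := hf.exists_monotone
    (R := fun f' => OrbitMeets u U (ofBasis f') → OrbitMeets u U (ofBasis f)) (by
      intro f' ℓ' i j hf' hij hℓ hR hs
      have hi : ℓ' i ≤ 2 := hf'.basis_mem_iff.mp (show f' i ∈ (⊤ : Submodule K V) from trivial)
      have huj : u (f' j) = 0 := hf'.basis_mem_iff (j := 1) |>.mpr (by omega)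
      have hui : ∀ v, f'.repr (u v) i = 0 := fun v => by
        by_contra hne
        have := hf'.mem_iff (j := 0) |>.mp (show u v ∈ LinearMap.range u from ⟨v, rfl⟩) i hne
        omega
      -- The rank one map commutes with `u` because both composites vanish: `f' j` is in the kernel,
      -- and the `i`-th coordinate kills the image since the level of `i` is positive.
      refine hR (OrbitMeets.of_swap hU hij (h := (f'.coord i).smulRight (f' j)) ?_ ?_ ?_ ?_ hs)
      · intro v
        simp [hui, huj]
      · simp
      · intro k _ hki
        simp [hki]
      · intro k hjk
        have : k ≠ i := (hij.trans hjk).ne'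
        simp [this]) id
  exact ⟨ofBasis f', hR, hf'.eq_space hℓ' (j := 0) hs, hf'.eq_space hℓ' (j := 1) hr⟩

theorem finrank_map_of_ker_le [FiniteDimensional K V] {u : Module.End K V} {S : Submodule K V}
    (h : LinearMap.ker u ≤ S) :
    Module.finrank K (S.map u) + Module.finrank K (LinearMap.ker u) = Module.finrank K S := by
  have h1 := LinearMap.finrank_range_add_finrank_ker (u.domRestrict S)
  rw [LinearMap.range_domRestrict, LinearMap.ker_domRestrict] at h1
  rw [← h1]
  congr 1
  exact (Submodule.comapSubtypeEquivOfLe h).finrank_eq.symm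

/-- A flag through the image and the kernel of `u` degenerates to one where, moreover, `u` maps the
part above the kernel to the part below the image. -/
theorem exists_map_space_eq_space [Infinite K] [FiniteDimensional K V] {r s : ℕ} (hsr : s ≤ r)
    {u : Module.End K V} (huu : ∀ v, u (u v) = 0) {U : Set (CompleteFlag K V (r + s))}
    (hU : IsOpen U) (F : CompleteFlag K V (r + s))
    (hFs : F.space ⟨s, by omega⟩ = LinearMap.range u)
    (hFr : F.space ⟨r, by omega⟩ = LinearMap.ker u) :
    ∃ G : CompleteFlag K V (r + s), (OrbitMeets u U G → OrbitMeets u U F) ∧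
      G.space ⟨r, by omega⟩ = LinearMap.ker u ∧
      ∀ (j : ℕ) (hj : j ≤ s), (G.space ⟨r + j, by omega⟩).map u = G.space ⟨j, by omega⟩ := by
  -- As `F_{r+j}` contains the kernel, `u(F_{r+j})` has dimension `j`. The extra level `s + 1`,
  -- equal to `V`, gives every basis vector a level.
  let A : ℕ → Submodule K V := fun j =>
    if h : j ≤ s then (F.space ⟨r + j, by omega⟩).map u else ⊤
  have hAj : ∀ (j : ℕ) (hj : j ≤ s), A j = (F.space ⟨r + j, by omega⟩).map u := fun j hj =>
    dif_pos hj
  have hAtop : A (s + 1) = ⊤ := dif_neg (by omega)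
  have hAs : A s = F.space ⟨s, by omega⟩ := by
    rw [hAj s le_rfl, hFs, LinearMap.range_eq_map]
    exact congrArg _ F.top
  have hA : Monotone A := by
    refine monotone_nat_of_le_succ fun j => ?_
    by_cases hj : j + 1 ≤ s
    · rw [hAj j (by omega), hAj (j + 1) hj]
      exact Submodule.map_mono (F.mono (by simp [Fin.le_def]))
    · simp only [A, dif_neg hj]
      exact le_top
  have hAr : ∀ (j : ℕ) (hj : j ≤ s), Module.finrank K (A j) = j := fun j hj => by
    have h1 := finrank_map_of_ker_le (u := u) (S := F.space ⟨r + j, by omega⟩)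
      (by rw [← hFr]; exact F.mono (by simp [Fin.le_def]))
    rw [← hFr, F.finrank_space, F.finrank_space] at h1
    rw [hAj j hj]
    simp only at h1
    omega
  obtain ⟨f, ℓ, hfF, hf⟩ := exists_isAdapted F hA hAtop
  obtain ⟨f', ℓ', hℓ', hf', hR, hO⟩ := hf.exists_monotone
    (R := fun f' => (∀ l : Fin (r + s + 1), s ≤ (l : ℕ) → (ofBasis f').space l = F.space l) ∧
      (OrbitMeets u U (ofBasis f') → OrbitMeets u U F)) (by
      rintro f' ℓ' i j hf' hij hℓ ⟨hR, hO⟩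
      have hi : ℓ' i ≤ s + 1 :=
        hf'.basis_mem_iff.mp (hAtop ▸ (trivial : f' i ∈ (⊤ : Submodule K V)))
      have hjA : f' j ∈ A s := hf'.basis_mem_iff.mpr (by omega)
      -- Inversions occur only among the first `s` places, so the subspaces of dimension at least
      -- `s`, which define `A`, never change.
      have hjs : (j : ℕ) < s := by
        rw [hAs, ← hR _ le_rfl, basis_mem_ofBasis_space] at hjA
        exact hjA
      refine ⟨fun l hl => ?_, fun hs => hO ?_⟩
      · rw [ofBasis_reindex_swap_space hij (by simp only [Fin.lt_def, Fin.val_castSucc]; omega)]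
        exact hR l hl
      have huk : ∀ k : Fin (r + s), (k : ℕ) < r → u (f' k) = 0 := fun k hk => by
        have : f' k ∈ (ofBasis f').space ⟨r, by omega⟩ := basis_mem_ofBasis_space.mpr hk
        rw [hR _ hsr, hFr] at this
        exact this
      have hjℓ : f' j ∈ A (ℓ' j) := hf'.basis_mem_iff.mpr le_rfl
      rw [hAj _ (by omega)] at hjℓ
      obtain ⟨y, hy, huy⟩ := hjℓ
      have hij' : (i : ℕ) < j := hij
      -- The rank one map alone need not commute with `u`. As `u y = f' j`, the second term corrects
      -- it: both composites become `v ↦ f'.coord i (u v) • f' j`. The level of `j` being smaller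
      -- than that of `i` keeps `y` inside the subspaces where it is needed.
      refine OrbitMeets.of_swap hU hij (h := (f'.coord i).smulRight (f' j) +
        ((f'.coord i).comp u).smulRight y) ?_ ?_ ?_ ?_ hs
      · intro v
        simp [huu, huk j (by omega), huy]
      · simp [huk i (by omega)]
      · intro k hkj hki
        have hkj' : (k : ℕ) ≤ j := hkj
        simp [hki, huk k (by omega)]
      · intro k hjk
        have hki : k ≠ i := (hij.trans hjk).ne'
        by_cases hkr : (k : ℕ) < r
        · simp [hki, huk k hkr]
        · by_cases hc : f'.repr (u (f' k)) i = 0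
          · simp [hki, hc]
          · have hk : f' k ∈ F.space ⟨r + (k - r + 1), by omega⟩ := by
              rw [← hR _ (by simp only; omega), basis_mem_ofBasis_space]
              simp only [Fin.lt_def, Fin.val_castSucc]
              omega
            have hkA : u (f' k) ∈ A (k - r + 1) := by
              rw [hAj _ (by omega)]
              exact Submodule.mem_map_of_mem hk
            have hle := hf'.mem_iff.mp hkA i hc
            have hyk : y ∈ (ofBasis f').space k.succ := by
              rw [hR _ (by simp only [Fin.val_succ]; omega)]
              refine F.mono ?_ hy
              simp only [Fin.le_def, Fin.val_succ]
              omega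
            simpa [hki] using Submodule.smul_mem _ _ hyk)
    ⟨fun l _ => by rw [hfF], fun h => hfF ▸ h⟩
  refine ⟨ofBasis f', hO, by rw [hR _ hsr, hFr], fun j hj => ?_⟩
  rw [hR _ (by simp only; omega), ← hAj j hj]
  exact (hf'.eq_space hℓ' (hAr j hj)).symm

/-- A flag which is compatible with `u` as the standard flag is equivalent to the standard flag under
the centralizer of `u`. -/
theorem exists_map_eq_ofBasis [FiniteDimensional K V] {r s : ℕ} (hsr : s ≤ r)
    {u : Module.End K V} {e : Module.Basis (Fin (r + s)) K V}
    (hu₁ : ∀ i : Fin r, u (e (Fin.castAdd s i)) = 0)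
    (hu₂ : ∀ j : Fin s, u (e (Fin.natAdd r j)) = e (Fin.castAdd s (Fin.castLE hsr j)))
    (F : CompleteFlag K V (r + s)) (hFr : F.space ⟨r, by omega⟩ = LinearMap.ker u)
    (hF : ∀ (j : ℕ) (hj : j ≤ s), (F.space ⟨r + j, by omega⟩).map u = F.space ⟨j, by omega⟩) :
    ∃ g : V ≃ₗ[K] V, (∀ v, g (u v) = u (g v)) ∧ F.map g = ofBasis e := by
  obtain ⟨f, rfl⟩ := F.exists_ofBasis_eq
  -- Replacing the first `s` vectors by the images of the last `s` keeps the flag and puts `u` in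
  -- the normal form it has on `e`.
  obtain ⟨b, hb, hbF⟩ := (ofBasis f).exists_basis_of_mem_of_notMem
    (fun k => if h : (k : ℕ) < s then u (f ⟨r + k, by omega⟩) else f k) (fun k => by
      by_cases hk : (k : ℕ) < s
      · simp only [dif_pos hk]
        have := hF (k + 1) hk
        have h2 : u (f ⟨r + k, by omega⟩) ∈ (ofBasis f).space ⟨k + 1, by omega⟩ := by
          rw [← this]
          refine Submodule.mem_map_of_mem (basis_mem_ofBasis_space.mpr ?_)
          simp [Fin.lt_def]
        exact h2
      · simp only [dif_neg hk]
        exact basis_mem_ofBasis_space.mpr Fin.castSucc_lt_succ) (fun k => by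
      by_cases hk : (k : ℕ) < s
      · simp only [dif_pos hk]
        intro hc
        have h2 : u (f ⟨r + k, by omega⟩) ∈ (ofBasis f).space ⟨k, by omega⟩ := hc
        rw [← hF k hk.le] at h2
        obtain ⟨z, hz, hzu⟩ := h2
        have h3 : f ⟨r + k, by omega⟩ - z ∈ (ofBasis f).space ⟨r, by omega⟩ := by
          rw [hFr, LinearMap.mem_ker, map_sub, hzu, sub_self]
        have h4 := add_mem ((ofBasis f).mono
          (show (⟨r, by omega⟩ : Fin (r + s + 1)) ≤ ⟨r + k, by omega⟩ by simp [Fin.le_def]) h3) hz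
        rw [sub_add_cancel, basis_mem_ofBasis_space] at h4
        simp at h4
      · simp only [dif_neg hk]
        intro hc
        exact lt_irrefl _ (basis_mem_ofBasis_space.mp hc))
  have hb₁ : ∀ i : Fin r, u (b (Fin.castAdd s i)) = 0 := fun i => by
    have : b (Fin.castAdd s i) ∈ (ofBasis b).space ⟨r, by omega⟩ :=
      basis_mem_ofBasis_space.mpr (by simp [Fin.lt_def])
    rw [hbF, hFr] at this
    exact this
  have hb₂ : ∀ j : Fin s, u (b (Fin.natAdd r j)) = b (Fin.castAdd s (Fin.castLE hsr j)) :=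
    fun j => by
    rw [hb]
    have h1 : ¬ (Fin.natAdd r j : ℕ) < s := by simp only [Fin.val_natAdd]; omega
    simp only [dif_neg h1]
    have h2 : (Fin.castAdd s (Fin.castLE hsr j) : ℕ) < s := by simp
    rw [dif_pos h2]
    rfl
  refine ⟨b.equiv e (Equiv.refl _), ?_, ?_⟩
  · have : ((b.equiv e (Equiv.refl _) : V →ₗ[K] V) ∘ₗ u) =
        u ∘ₗ (b.equiv e (Equiv.refl _) : V →ₗ[K] V) := by
      refine b.ext fun k => ?_
      induction k using Fin.addCases with
      | left i => simp [hb₁, hu₁]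
      | right j => simp [hb₂, hu₂]
    exact fun v => LinearMap.congr_fun this v
  · rw [← hbF, map_ofBasis]
    congr 1
    ext k
    simp

/-- The standard flag lies in the closure of every orbit of the centralizer of `u`. -/
theorem orbitMeets_of_ofBasis_mem [Infinite K] [FiniteDimensional K V] {r s : ℕ} (hsr : s ≤ r)
    {u : Module.End K V} {e : Module.Basis (Fin (r + s)) K V}
    (hu₁ : ∀ i : Fin r, u (e (Fin.castAdd s i)) = 0)
    (hu₂ : ∀ j : Fin s, u (e (Fin.natAdd r j)) = e (Fin.castAdd s (Fin.castLE hsr j)))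
    {U : Set (CompleteFlag K V (r + s))} (hU : IsOpen U) (he : ofBasis e ∈ U)
    (F : CompleteFlag K V (r + s)) : OrbitMeets u U F := by
  have huu : ∀ v, u (u v) = 0 := by
    have : u ∘ₗ u = 0 := by
      refine e.ext fun k => ?_
      induction k using Fin.addCases with
      | left i => simp [hu₁]
      | right j => simp [hu₁, hu₂]
    exact fun v => LinearMap.congr_fun this v
  have hrange : (ofBasis e).space ⟨s, by omega⟩ = LinearMap.range u := by
    refine le_antisymm ((Module.Basis.flag_le_iff _).mpr fun k hk => ?_) ?_
    · have hk' : (k : ℕ) < s := hk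
      exact ⟨e (Fin.natAdd r ⟨k, hk'⟩), hu₂ _⟩
    · rw [LinearMap.range_eq_map, ← e.span_eq, Submodule.map_span, Submodule.span_le]
      rintro _ ⟨_, ⟨k, rfl⟩, rfl⟩
      induction k using Fin.addCases with
      | left i => rw [hu₁]; exact Submodule.zero_mem _
      | right j =>
        rw [hu₂]
        exact basis_mem_ofBasis_space.mpr (by simp [Fin.lt_def])
  have hs : Module.finrank K (LinearMap.range u) = s := by rw [← hrange, finrank_space]
  have hr : Module.finrank K (LinearMap.ker u) = r := by
    have h1 := LinearMap.finrank_range_add_finrank_ker u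
    rw [hs, Module.finrank_eq_card_basis e, Fintype.card_fin] at h1
    omega
  obtain ⟨G, hG, hGs, hGr⟩ := exists_space_eq_range_ker huu (s := ⟨s, by omega⟩)
    (r := ⟨r, by omega⟩) hs hr hU F
  obtain ⟨G', hG', hGr', hGj⟩ := exists_map_space_eq_space hsr huu hU G hGs hGr
  obtain ⟨g, hg, hge⟩ := exists_map_eq_ofBasis hsr hu₁ hu₂ G' hGr' hGj
  exact hG (hG' ⟨g, hg, hge ▸ he⟩)

end CompleteFlag

/-! ### Components of the Springer fiber and their symmetries -/

namespace CompleteFlag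

variable {K V : Type*} [Field K] [AddCommGroup V] [Module K V] {n : ℕ}

theorem isIrreducible_of_mem_components {B Z : Set (CompleteFlag K V n)} (hZ : Z ∈ components B) :
    IsIrreducible Z := by
  obtain ⟨Z', hZ', rfl⟩ := hZ
  exact hZ'.1.image _ continuous_subtype_val.continuousOn

theorem subset_of_mem_components {B Z : Set (CompleteFlag K V n)} (hZ : Z ∈ components B) :
    Z ⊆ B := by
  obtain ⟨Z', -, rfl⟩ := hZ
  exact Subtype.coe_image_subset B Z'

theorem exists_isClosed_of_mem_components {B Z : Set (CompleteFlag K V n)}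
    (hZ : Z ∈ components B) : ∃ C, IsClosed C ∧ Z = B ∩ C := by
  obtain ⟨Z', hZ', rfl⟩ := hZ
  obtain ⟨C, hC, hCZ⟩ := isClosed_induced_iff.mp (isClosed_of_mem_irreducibleComponents _ hZ')
  exact ⟨C, hC, by
    rw [← hCZ]
    exact Subtype.image_preimage_coe B C⟩

theorem subset_of_isIrreducible_of_mem_components {B Z Y : Set (CompleteFlag K V n)}
    (hZ : Z ∈ components B) (hYB : Y ⊆ B) (hY : IsIrreducible Y) (hZY : Z ⊆ Y) : Y ⊆ Z := by
  obtain ⟨Z', hZ', rfl⟩ := hZ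
  have h1 : IsIrreducible (Subtype.val ⁻¹' Y : Set B) := by
    refine ⟨?_, ?_⟩
    · obtain ⟨y, hy⟩ := hY.1
      exact ⟨⟨y, hYB hy⟩, hy⟩
    · intro O₁ O₂ hO₁ hO₂ h₁ h₂
      obtain ⟨W₁, hW₁, rfl⟩ := isOpen_induced_iff.mp hO₁
      obtain ⟨W₂, hW₂, rfl⟩ := isOpen_induced_iff.mp hO₂
      obtain ⟨y₁, hy₁, hy₁'⟩ := h₁
      obtain ⟨y₂, hy₂, hy₂'⟩ := h₂
      obtain ⟨y, hy, hy'⟩ := hY.2 W₁ W₂ hW₁ hW₂ ⟨y₁, hy₁, hy₁'⟩ ⟨y₂, hy₂, hy₂'⟩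
      exact ⟨⟨y, hYB hy⟩, hy, hy'⟩
  have h2 := hZ'.2 h1 (Set.image_subset_iff.mp hZY)
  intro y hy
  exact ⟨⟨y, hYB hy⟩, h2 hy, rfl⟩

theorem map_mem_springerFiber {u : Module.End K V} {g : V ≃ₗ[K] V} (hg : ∀ v, g (u v) = u (g v))
    {F : CompleteFlag K V n} (hF : F ∈ springerFiber n u) : F.map g ∈ springerFiber n u := by
  rintro i _ ⟨v, hv, rfl⟩
  exact ⟨u v, hF i v hv, hg v⟩

theorem ofBasis_mem_springerFiber {r s : ℕ} (hsr : s ≤ r) {u : Module.End K V}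
    {e : Module.Basis (Fin (r + s)) K V} (hu₁ : ∀ i : Fin r, u (e (Fin.castAdd s i)) = 0)
    (hu₂ : ∀ j : Fin s, u (e (Fin.natAdd r j)) = e (Fin.castAdd s (Fin.castLE hsr j))) :
    ofBasis e ∈ springerFiber (r + s) u := by
  intro i
  refine (Module.Basis.flag_le_iff (p := ((ofBasis e).space i).comap u) e).mpr fun k hk => ?_
  rw [Submodule.mem_comap]
  induction k using Fin.addCases with
  | left k => rw [hu₁]; exact Submodule.zero_mem _
  | right j =>
    rw [hu₂, basis_mem_ofBasis_space]
    refine lt_of_le_of_lt ?_ hk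
    simp only [Fin.le_def, Fin.val_castSucc, Fin.val_castAdd, Fin.val_castLE, Fin.val_natAdd]
    omega

/-- The translates of an irreducible set of flags under the centralizer of `u` form an irreducible
set. -/
theorem isIrreducible_setOf_map [Infinite K] [FiniteDimensional K V] (u : Module.End K V)
    {Z : Set (CompleteFlag K V n)} (hZ : IsIrreducible Z) :
    IsIrreducible {F | ∃ g : V ≃ₗ[K] V, (∀ v, g (u v) = u (g v)) ∧ ∃ F' ∈ Z, F'.map g = F} := by
  refine ⟨?_, ?_⟩
  · obtain ⟨F, hF⟩ := hZ.1
    exact ⟨F, LinearEquiv.refl K V, fun _ => rfl, F, hF, map_refl F⟩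
  · rintro U₁ U₂ hU₁ hU₂ ⟨_, ⟨g₁, hg₁, F₁, hF₁, rfl⟩, h₁⟩ ⟨_, ⟨g₂, hg₂, F₂, hF₂, rfl⟩, h₂⟩
    obtain ⟨F, hF, hFU₁, hFU₂⟩ := hZ.2 _ _ (isOpen_preimage_map g₁ hU₁)
      (isOpen_preimage_map g₂ hU₂) ⟨F₁, hF₁, h₁⟩ ⟨F₂, hF₂, h₂⟩
    obtain ⟨b, rfl⟩ := F.exists_ofBasis_eq
    rw [Set.mem_preimage, map_ofBasis] at hFU₁ hFU₂
    have hfin₁ := finite_setOf_ofBasis_notMem hU₁ hFU₁ fun i => g₂ (b i) - g₁ (b i)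
    -- The same line from its other end: `γ = g₂ + (1 - t) (g₁ - g₂)`.
    have hfin₂ := (finite_setOf_ofBasis_notMem hU₂ hFU₂ fun i => g₁ (b i) - g₂ (b i)).preimage
      (f := fun t : K => 1 - t) (sub_right_injective).injOn
    have hfin₃ := finite_setOf_not_isUnit_add_smul g₁ ((g₂ : Module.End K V) - g₁)
    obtain ⟨t, ht⟩ := ((hfin₁.union hfin₂).union hfin₃).exists_notMem
    simp only [Set.mem_union, not_or, Set.mem_preimage, Set.mem_ofPred_eq, not_not, not_exists,
      not_and] at ht
    obtain ⟨⟨ht₁, ht₂⟩, ht₃⟩ := ht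
    let γ : V ≃ₗ[K] V := LinearEquiv.ofBijective _ ((Module.End.isUnit_iff _).mp ht₃)
    have hγ : ∀ v, γ v = g₁ v + t • (g₂ v - g₁ v) := fun v => rfl
    refine ⟨(ofBasis b).map γ, ⟨γ, fun v => ?_, _, hF, rfl⟩, ?_, ?_⟩
    · simp [hγ, hg₁, hg₂]
    · rw [map_ofBasis]
      exact ht₁ _ fun i => by simp [hγ]
    · rw [map_ofBasis]
      refine ht₂ _ fun i => ?_
      simp only [Module.Basis.map_apply, hγ]
      module

/-- The union of all translates of `Z` is irreducible, lies in the Springer fiber and contains `Z`,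
so it is `Z` by maximality. -/
theorem map_mem_of_mem_components [Infinite K] [FiniteDimensional K V] {u : Module.End K V}
    {Z : Set (CompleteFlag K V n)} (hZ : Z ∈ components (springerFiber n u)) {g : V ≃ₗ[K] V}
    (hg : ∀ v, g (u v) = u (g v)) {F : CompleteFlag K V n} (hF : F ∈ Z) : F.map g ∈ Z := by
  refine subset_of_isIrreducible_of_mem_components hZ ?_
    (isIrreducible_setOf_map u (isIrreducible_of_mem_components hZ)) ?_ ⟨g, hg, F, hF, rfl⟩
  · rintro _ ⟨g, hg, F, hF, rfl⟩
    exact map_mem_springerFiber hg (subset_of_mem_components hZ hF)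
  · exact fun F hF => ⟨LinearEquiv.refl K V, fun _ => rfl, F, hF, map_refl F⟩

theorem chartTrace_map {Z : Set (CompleteFlag K V n)} {g : V ≃ₗ[K] V}
    (hg : ∀ F, F ∈ Z ↔ F.map g ∈ Z) (b : Module.Basis (Fin n) K V) :
    chartTrace Z (b.map g) = chartTrace Z b := by
  ext x
  constructor
  · rintro ⟨F, hF, hx⟩
    refine ⟨F.map g.symm, ?_, ?_⟩
    · rw [hg, map_map, LinearEquiv.symm_trans_self, map_refl]
      exact hF
    · have := hx.map g.symm
      convert this
      ext i
      simp
  · rintro ⟨F, hF, hx⟩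
    exact ⟨F.map g, (hg F).mp hF, hx.map g⟩

/-- A symmetry of `Z` carries the chart of `b` to that of `b.map g` with the same coordinates and
the same trace, so the local ring is unchanged. -/
theorem IsNonsingularPoint.map {Z : Set (CompleteFlag K V n)} {g : V ≃ₗ[K] V}
    (hg : ∀ F, F ∈ Z ↔ F.map g ∈ Z) {F : CompleteFlag K V n} (h : IsNonsingularPoint Z F) :
    IsNonsingularPoint Z (F.map g) := by
  obtain ⟨hF, b, x, hx, hreg⟩ := h
  refine ⟨(hg F).mp hF, b.map g, ⟨x, by rw [chartTrace_map hg]; exact x.2⟩, hx.map g, ?_⟩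
  have : ∀ (X Y : Set ({p : Fin n × Fin n // p.1 < p.2} → K)) (_ : X = Y) (x : X) (y : Y)
      (_ : (x : {p : Fin n × Fin n // p.1 < p.2} → K) = y),
      IsRegularLocalRing (affineLocalRing X x) → IsRegularLocalRing (affineLocalRing Y y) := by
    rintro X _ rfl x y hxy h
    obtain rfl := Subtype.ext hxy
    exact h
  exact this _ _ (chartTrace_map hg b).symm x _ rfl hreg

end CompleteFlag

/-! ### Coordinate rings of chart traces and nonsingular points -/

theorem exists_coordinateRing_eq {K σ : Type*} [Field K] {X : Set (σ → K)} (f : coordinateRing X) :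
    ∃ p : MvPolynomial σ K, ∀ x : X, (f : X → K) x = MvPolynomial.eval x.1 p := by
  obtain ⟨_, p, rfl⟩ := f
  exact ⟨p, fun x => aeval_fun_apply _ _ _⟩

theorem evalAt_algebraMap {K σ : Type*} [Field K] {X : Set (σ → K)} (x : X) (c : K) :
    evalAt X x (algebraMap K (coordinateRing X) c) = c := rfl

instance finiteType_coordinateRing {K σ : Type*} [Field K] [Finite σ] (X : Set (σ → K)) :
    Algebra.FiniteType K (coordinateRing X) :=
  Algebra.FiniteType.of_surjective (MvPolynomial.aeval (fun (i : σ) (x : X) => (x : σ → K) i) :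
    MvPolynomial σ K →ₐ[K] (X → K)).rangeRestrict (AlgHom.rangeRestrict_surjective _)

namespace CompleteFlag

variable {K V : Type*} [Field K] [AddCommGroup V] [Module K V] {n : ℕ}

/-- Two nonzero functions are nonvanishing on nonempty open parts of `Z`, which meet by
irreducibility. -/
theorem isDomain_coordinateRing_chartTrace [FiniteDimensional K V]
    {Z : Set (CompleteFlag K V n)} (hZ : IsIrreducible Z) (b : Module.Basis (Fin n) K V)
    (hne : (chartTrace Z b).Nonempty) : IsDomain (coordinateRing (chartTrace Z b)) := by
  obtain ⟨x₀, hx₀⟩ := hne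
  have : Nontrivial (coordinateRing (chartTrace Z b)) :=
    (evalAt (chartTrace Z b) ⟨x₀, hx₀⟩).domain_nontrivial
  have : NoZeroDivisors (coordinateRing (chartTrace Z b)) := by
    refine ⟨fun {f g} hfg => ?_⟩
    by_contra! hne
    obtain ⟨p, hp⟩ := exists_coordinateRing_eq f
    obtain ⟨q, hq⟩ := exists_coordinateRing_eq g
    have hex : ∀ {f : coordinateRing (chartTrace Z b)} {p}, f ≠ 0 →
        (∀ x : chartTrace Z b, (f : chartTrace Z b → K) x = MvPolynomial.eval x.1 p) →
        (Z ∩ {F | ∃ x, F.HasCoordinates b x ∧ MvPolynomial.eval x p ≠ 0}).Nonempty := by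
      intro f p hf hp
      by_contra hem
      refine hf (Subtype.ext (funext fun x => ?_))
      obtain ⟨F, hF, hx⟩ := x.2
      rw [hp]
      by_contra h
      exact hem ⟨F, hF, x, hx, h⟩
    obtain ⟨F, hF, ⟨x, hx, hxp⟩, ⟨y, hy, hyq⟩⟩ := hZ.2 _ _
      (isOpen_setOf_hasCoordinates_eval_ne_zero b p) (isOpen_setOf_hasCoordinates_eval_ne_zero b q)
      (hex hne.1 hp) (hex hne.2 hq)
    obtain rfl := hx.unique hy
    have h1 := congrFun (congrArg Subtype.val hfg) ⟨x, F, hF, hx⟩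
    have h2 : (f : chartTrace Z b → K) ⟨x, F, hF, hx⟩ * (g : chartTrace Z b → K) ⟨x, F, hF, hx⟩ = 0 :=
      h1
    rw [hp, hq] at h2
    exact (mul_ne_zero hxp hyq) h2
  exact NoZeroDivisors.to_isDomain _

/-- The nonsingular points of an irreducible set of flags form an open subset. -/
theorem IsNonsingularPoint.exists_isOpen [FiniteDimensional K V] {Z : Set (CompleteFlag K V n)}
    (hZ : IsIrreducible Z) {F : CompleteFlag K V n} (h : IsNonsingularPoint Z F) :
    ∃ U, IsOpen U ∧ F ∈ U ∧ ∀ G ∈ Z ∩ U, IsNonsingularPoint Z G := by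
  obtain ⟨hF, b, x, hx, hreg⟩ := h
  have := isDomain_coordinateRing_chartTrace hZ b ⟨x, x.2⟩
  obtain ⟨a, ha, hreg'⟩ := exists_forall_isRegularLocalRing_localization (K := K)
    (evalAt (chartTrace Z b) x) (evalAt_algebraMap x) hreg
  obtain ⟨p, hp⟩ := exists_coordinateRing_eq a
  refine ⟨_, isOpen_setOf_hasCoordinates_eval_ne_zero b p, ⟨x, hx, ?_⟩, ?_⟩
  · rw [← hp]
    exact ha
  · rintro G ⟨hG, y, hy, hyp⟩
    refine ⟨hG, b, ⟨y, G, hG, hy⟩, hy, hreg' (evalAt (chartTrace Z b) ⟨y, G, hG, hy⟩)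
      (evalAt_algebraMap _) ?_⟩
    have := hp ⟨y, G, hG, hy⟩
    rw [← this] at hyp
    exact hyp

end CompleteFlag

/-! ### The main theorem -/

theorem proposition2p1 {K V : Type*} [Field K] [IsAlgClosed K] [AddCommGroup V] [Module K V]
    (r s : ℕ) (hsr : s ≤ r) (u : Module.End K V) (e : Module.Basis (Fin (r + s)) K V)
    (hu₁ : ∀ i : Fin r, u (e (Fin.castAdd s i)) = 0)
    (hu₂ : ∀ j : Fin s, u (e (Fin.natAdd r j)) = e (Fin.castAdd s (Fin.castLE hsr j))) :
    (∀ Z ∈ CompleteFlag.components (springerFiber (r + s) u), CompleteFlag.ofBasis e ∈ Z) ∧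
    (∀ Z ∈ CompleteFlag.components (springerFiber (r + s) u),
      CompleteFlag.IsNonsingular Z ↔
        CompleteFlag.IsNonsingularPoint Z (CompleteFlag.ofBasis e)) := by
  have : Infinite K := IsAlgClosed.instInfinite
  have : FiniteDimensional K V := e.finiteDimensional_of_finite
  have hmem : ∀ Z ∈ CompleteFlag.components (springerFiber (r + s) u),
      CompleteFlag.ofBasis e ∈ Z := by
    intro Z hZ
    obtain ⟨C, hC, hZC⟩ := CompleteFlag.exists_isClosed_of_mem_components hZ
    obtain ⟨F, hF⟩ := (CompleteFlag.isIrreducible_of_mem_components hZ).1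
    by_contra hne
    have heC : CompleteFlag.ofBasis e ∈ Cᶜ := fun h =>
      hne (hZC ▸ ⟨CompleteFlag.ofBasis_mem_springerFiber hsr hu₁ hu₂, h⟩)
    obtain ⟨g, hg, hgC⟩ :=
      CompleteFlag.orbitMeets_of_ofBasis_mem hsr hu₁ hu₂ hC.isOpen_compl heC F
    have hgZ := CompleteFlag.map_mem_of_mem_components hZ hg hF
    rw [hZC] at hgZ
    exact hgC hgZ.2
  refine ⟨hmem, fun Z hZ => ⟨fun h => h _ (hmem Z hZ), fun h F hF => ?_⟩⟩
  obtain ⟨U, hU, heU, hUZ⟩ :=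
    h.exists_isOpen (CompleteFlag.isIrreducible_of_mem_components hZ)
  -- Move `F` into the nonsingular neighbourhood of the standard flag, then transport nonsingularity
  -- back by `g.symm`.
  obtain ⟨g, hg, hgU⟩ := CompleteFlag.orbitMeets_of_ofBasis_mem hsr hu₁ hu₂ hU heU F
  have hg' : ∀ v, g.symm (u v) = u (g.symm v) := fun v => by
    rw [LinearEquiv.symm_apply_eq, hg, LinearEquiv.apply_symm_apply]
  have h1 := hUZ _ ⟨CompleteFlag.map_mem_of_mem_components hZ hg hF, hgU⟩
  have h2 := h1.map (g := g.symm) fun G =>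
    ⟨fun hG => CompleteFlag.map_mem_of_mem_components hZ hg' hG, fun hG => by
      have := CompleteFlag.map_mem_of_mem_components hZ hg hG
      rwa [CompleteFlag.map_map, LinearEquiv.symm_trans_self, CompleteFlag.map_refl] at this⟩
  rwa [CompleteFlag.map_map_symm] at h2
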